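/- Let $\mathcal A$ be a compact set of real $2\times 2$ matrices that is irreducible, i.e. its matrices have no common invariant subspace other than $\{0\}$ and $\mathbb R^2$. A trajectory of the linear switching system $\mathcal A$ is a locally absolutely continuous $x:[0,\infty)\to\mathbb R^2$ with $\dot x(t)=A(t)x(t)$ for almost all $t\ge 0$, where the switching law $A:[0,\infty)\to\mathcal A$ is measurable; the system is stable if all its trajectories tend to zero as $t\to\infty$. A point $x\in\mathbb R^2$ is feasible if no $A\in\mathcal A$ satisfies $Ax=\lambda x$ with $\lambda\ge 0$. At a feasible $x$, a leading left matrix is a matrix $A\in\mathcal A$ for which the oriented (counterclockwise) angle from $x$ to $Ax$ lies in $(0,\pi)$, is the smallest among all angles in $(0,\pi)$ from $x$ to $Bx$ with $B\in\mathcal A$, and for which $Ax$ is longest among the images $Bx$, $B\in\mathcal A$, forming this smallest angle. A leading right matrix is defined in the same way with the largest angle in $(-\pi,0)$. A leading left (right) trajectory is a trajectory with $x(0)\ne0$ whose switching law $A(t)$ is, for each $t$, a leading left (right) matrix at $x(t)$. It is round, with half-turn time $T>0$ and factor $\lambda>0$, if $x(T)=-\lambda x(0)$, $T$ is the first positive time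 at which $x$ has the direction of $-x(0)$, and the switching law is $T$-periodic; a round leading trajectory is decreasing if $\lambda<1$. Then $\mathcal A$ is stable if and only if the convex hull $\mathrm{co}(\mathcal A)$ contains no matrix with a nonnegative (real) eigenvalue and every round leading trajectory, left or right, is decreasing (this condition being void for a side on which there are none). The starting point can be arbitrary: for each fixed $x_0\ne0$ the same equivalence holds when only the round leading trajectories starting at $x_0$ are considered, and if there is a round leading left (respectively right) trajectory with half-turn time $T$ and factor $\lambda$, then there is one with the same $T$ and $\lambda$ starting at every $x_0\neq0$. -/

import Mathlib

open Matrix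

/-- Vectors of the plane `ℝ²`. -/
abbrev Vec2 : Type := Fin 2 → ℝ

/-- Real `2 × 2` matrices. -/
abbrev Mat2 : Type := Matrix (Fin 2) (Fin 2) ℝ

/-- The plane identified with `ℂ`; the complex modulus is the Euclidean length and multiplication
by a number of positive argument is a counterclockwise (positive) rotation. -/
noncomputable def toC (v : Vec2) : ℂ := ⟨v 0, v 1⟩

/-- Euclidean length. -/
noncomputable def euclLength (v : Vec2) : ℝ := ‖toC v‖

/-- The oriented angle from `x` to `y`, with values in `(-π, π]`: the angle of the counterclockwise
rotation taking the direction of `x` to that of `y` (for nonzero `x`, `y`). -/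
noncomputable def orientedAngle (x y : Vec2) : ℝ := (toC y / toC x).arg

/-- The matrices of `𝒜` share no invariant subspace other than `0` and the plane. -/
def IrreducibleFamily (𝒜 : Set Mat2) : Prop :=
  ∀ W : Submodule ℝ Vec2, (∀ A ∈ 𝒜, ∀ v ∈ W, A *ᵥ v ∈ W) → W = ⊥ ∨ W = ⊤

/-- `x`, on the half-line `t ≥ 0`, is a trajectory of the linear switching system with control
set `𝒜` for the measurable switching law `A`: a (locally absolutely continuous, Carathéodory)
solution of `x' = A(t) x`, written in integral form. -/
structure IsTrajectory (𝒜 : Set Mat2) (A : ℝ → Mat2) (x : ℝ → Vec2) : Prop where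
  measurable_law : ∀ i j, Measurable fun t => A t i j
  law_mem : ∀ t, 0 ≤ t → A t ∈ 𝒜
  continuousOn : ContinuousOn x (Set.Ici 0)
  solves : ∀ t, 0 ≤ t → x t = x 0 + ∫ s in (0 : ℝ)..t, A s *ᵥ x s

/-- (Asymptotic) stability: all trajectories tend to zero. -/
def StableSystem (𝒜 : Set Mat2) : Prop :=
  ∀ (A : ℝ → Mat2) (x : ℝ → Vec2), IsTrajectory 𝒜 A x →
    Filter.Tendsto x Filter.atTop (nhds 0)

/-- `x` is feasible: no matrix of `𝒜` maps `x` to `c x` with `c ≥ 0`. -/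
def Feasible (𝒜 : Set Mat2) (x : Vec2) : Prop :=
  ¬ ∃ A ∈ 𝒜, ∃ c : ℝ, 0 ≤ c ∧ A *ᵥ x = c • x

/-- `A` is a leading left matrix at `x`: among the matrices `B ∈ 𝒜` such that the oriented angle
from `x` to `B x` lies in `(0, π)` it gives the smallest angle and, among those, the longest
image. -/
structure IsLeadingLeft (𝒜 : Set Mat2) (x : Vec2) (A : Mat2) : Prop where
  feasible : Feasible 𝒜 x
  mem : A ∈ 𝒜
  angle_mem : orientedAngle x (A *ᵥ x) ∈ Set.Ioo 0 Real.pi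
  angle_le : ∀ B ∈ 𝒜, orientedAngle x (B *ᵥ x) ∈ Set.Ioo 0 Real.pi →
    orientedAngle x (A *ᵥ x) ≤ orientedAngle x (B *ᵥ x)
  length_le : ∀ B ∈ 𝒜, orientedAngle x (B *ᵥ x) = orientedAngle x (A *ᵥ x) →
    euclLength (B *ᵥ x) ≤ euclLength (A *ᵥ x)

/-- `A` is a leading right matrix at `x`: among the matrices `B ∈ 𝒜` such that the oriented angle
from `x` to `B x` lies in `(-π, 0)` it gives the largest angle and, among those, the longest
image. -/
structure IsLeadingRight (𝒜 : Set Mat2) (x : Vec2) (A : Mat2) : Prop where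
  feasible : Feasible 𝒜 x
  mem : A ∈ 𝒜
  angle_mem : orientedAngle x (A *ᵥ x) ∈ Set.Ioo (-Real.pi) 0
  le_angle : ∀ B ∈ 𝒜, orientedAngle x (B *ᵥ x) ∈ Set.Ioo (-Real.pi) 0 →
    orientedAngle x (B *ᵥ x) ≤ orientedAngle x (A *ᵥ x)
  length_le : ∀ B ∈ 𝒜, orientedAngle x (B *ᵥ x) = orientedAngle x (A *ᵥ x) →
    euclLength (B *ᵥ x) ≤ euclLength (A *ᵥ x)

/-- `x` makes a rotation about the origin with half-turn time `T` and factor `c`: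
`x T = -c x(0)`, `T` is the first positive time at which `x` has the direction opposite to `x 0`,
and the switching law is `T`-periodic. -/
structure IsRound (A : ℝ → Mat2) (x : ℝ → Vec2) (T c : ℝ) : Prop where
  start_ne_zero : x 0 ≠ 0
  time_pos : 0 < T
  factor_pos : 0 < c
  half_turn : x T = -(c • x 0)
  first_time : ∀ s, 0 < s → s < T → ¬ ∃ d : ℝ, 0 < d ∧ x s = -(d • x 0)
  periodic_law : ∀ t, 0 ≤ t → A (t + T) = A t

/-- `x` is a round leading left trajectory of `𝒜`, with switching law `A`, half-turn time `T` and
factor `c`. It is decreasing when `c < 1`. -/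
structure IsRoundLeft (𝒜 : Set Mat2) (A : ℝ → Mat2) (x : ℝ → Vec2) (T c : ℝ) : Prop where
  trajectory : IsTrajectory 𝒜 A x
  leading : ∀ t, 0 ≤ t → IsLeadingLeft 𝒜 (x t) (A t)
  round : IsRound A x T c

/-- `x` is a round leading right trajectory of `𝒜`, with switching law `A`, half-turn time `T` and
factor `c`. It is decreasing when `c < 1`. -/
structure IsRoundRight (𝒜 : Set Mat2) (A : ℝ → Mat2) (x : ℝ → Vec2) (T c : ℝ) : Prop where
  trajectory : IsTrajectory 𝒜 A x
  leading : ∀ t, 0 ≤ t → IsLeadingRight 𝒜 (x t) (A t)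
  round : IsRound A x T c

/-- Some matrix of the convex hull of `𝒜` has a (real) nonnegative eigenvalue. -/
def HullHasNonnegEigenvalue (𝒜 : Set Mat2) : Prop :=
  ∃ B ∈ convexHull ℝ 𝒜, ∃ c : ℝ, 0 ≤ c ∧ Module.End.HasEigenvalue (Matrix.toLin' B) c

/-- Every round leading left or right trajectory starting at `x₀` is decreasing. -/
def RoundDecreasingFrom (𝒜 : Set Mat2) (x₀ : Vec2) : Prop :=
  (∀ (A : ℝ → Mat2) (x : ℝ → Vec2) (T c : ℝ), x 0 = x₀ → IsRoundLeft 𝒜 A x T c → c < 1) ∧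
  (∀ (A : ℝ → Mat2) (x : ℝ → Vec2) (T c : ℝ), x 0 = x₀ → IsRoundRight 𝒜 A x T c → c < 1)

open MeasureTheory Set Filter Topology ComplexConjugate

/-! Identify the plane with `ℂ`. On the ray of argument `θ` a matrix multiplies by `q = dirQuot A
θ`, so a trajectory `r e^{iθ}` obeys `(log r)' = Re q` and `θ' = Im q`, with `q` of period `π` in
`θ`. Everything is thus a question about slopes `d(log r)/dθ` on the circle of directions modulo
`π`.

Sufficiency. Let `g` be continuous and `π`-periodic with `Re q < g(θ) Im q` for every matrix and
direction (`Admissible`), and let `G' = g`. Then `log r - G(θ)` decreases at a uniform rate along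
all trajectories. If `g` has mean zero, `G` is periodic and this yields a Lyapunov function on the
plane (`stable_of_slope`). Left-turning matrices bound `g` from below by their slopes, right-turning
ones bound it from above. Admissible fields form a convex set, so it is enough to find one of
negative and one of positive mean.

The absence of nonnegative eigenvalues in the hull says that the convex hull of the numbers `-q` in
each direction avoids the half-line `(-∞, 0]`. Their arguments therefore fill out less than an angle
`π`, which leaves room between the lower and the upper bounds. Push `g` down to its lower bound. If
some matrix turns left in every direction, that bound is the slope of the leading left trajectory,
whose integral over a half-turn is the logarithm of the factor (`exists_isRoundLeft`). A factor
below `1` thus gives a field of negative mean. If in some direction no matrix turns left, `g` may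
tend to `-∞` there, and a Lipschitz estimate shows that the integral diverges logarithmically to
`-∞` (`exists_admissible_of_left`). A reflection handles the other side.

Necessity. A round trajectory is multiplied by `-c` in each half-turn, so it tends to zero only if
`c < 1`. If `B` in the hull has an eigenvalue `c ≥ 0`, switching ever faster with mean `B` produces
a trajectory on which a left eigenvector of `B` stays bounded away from zero. -/

/-! ### Complex coordinate and the quotient `A u / u` -/

/-- The identification of the plane with `ℂ` as a continuous linear equivalence. -/
noncomputable def toCL : Vec2 ≃L[ℝ] ℂ :=
  LinearEquiv.toContinuousLinearEquiv
    { toFun := toC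
      invFun := fun z => ![z.re, z.im]
      map_add' := fun v w => by apply Complex.ext <;> simp [toC]
      map_smul' := fun r v => by apply Complex.ext <;> simp [toC]
      left_inv := fun v => by ext i; fin_cases i <;> simp [toC]
      right_inv := fun z => by apply Complex.ext <;> simp [toC] }

theorem toCL_apply (v : Vec2) : toCL v = toC v := rfl

theorem toC_symm_apply (z : ℂ) : toC (toCL.symm z) = z := toCL.apply_symm_apply z

theorem toC_injective : Function.Injective toC := toCL.injective

theorem toC_smul (r : ℝ) (v : Vec2) : toC (r • v) = r * toC v := by
  rw [← toCL_apply, map_smul, toCL_apply, Complex.real_smul]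

theorem toC_neg (v : Vec2) : toC (-v) = -toC v := by
  rw [← toCL_apply, map_neg, toCL_apply]

theorem toC_zero : toC 0 = 0 := by
  rw [← toCL_apply, map_zero]

theorem toC_eq_zero {v : Vec2} : toC v = 0 ↔ v = 0 := by
  rw [← toC_zero, toC_injective.eq_iff]

/-- The complex linear part of a real matrix acting on `ℂ`. -/
noncomputable def holPart (A : Mat2) : ℂ :=
  (((A 0 0 + A 1 1) / 2 : ℝ) : ℂ) + (((A 1 0 - A 0 1) / 2 : ℝ) : ℂ) * Complex.I

/-- The conjugate linear part of a real matrix acting on `ℂ`. -/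
noncomputable def antiPart (A : Mat2) : ℂ :=
  (((A 0 0 - A 1 1) / 2 : ℝ) : ℂ) + (((A 1 0 + A 0 1) / 2 : ℝ) : ℂ) * Complex.I

/-- The action of a real matrix on `ℂ`. -/
noncomputable def opC (A : Mat2) (z : ℂ) : ℂ := holPart A * z + antiPart A * conj z

/-- The quotient `A u / u` for the unit vector `u` of argument `θ`. -/
noncomputable def dirQuot (A : Mat2) (θ : ℝ) : ℂ :=
  holPart A + antiPart A * Complex.exp (-(2 * θ : ℝ) * Complex.I)

theorem toC_mulVec (A : Mat2) (v : Vec2) : toC (A *ᵥ v) = opC A (toC v) := by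
  apply Complex.ext <;>
    simp [toC, opC, holPart, antiPart, Matrix.mulVec, dotProduct, Fin.sum_univ_two] <;> ring

/-- Here `conj z / z = e^{-2iθ}`. Along a trajectory the real part of the quotient is the growth
rate of `log |z|`, and its imaginary part is the angular speed. -/
theorem opC_polar (A : Mat2) (r θ : ℝ) :
    opC A (r * Complex.exp (θ * Complex.I)) =
      dirQuot A θ * (r * Complex.exp (θ * Complex.I)) := by
  have h : Complex.exp (-(2 * θ : ℝ) * Complex.I) * Complex.exp (θ * Complex.I)
      = Complex.exp (-(θ * Complex.I)) := by
    rw [← Complex.exp_add]; congr 1; push_cast; ring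
  have h2 : conj (Complex.exp (θ * Complex.I)) = Complex.exp (-(θ * Complex.I)) := by
    rw [← Complex.exp_conj]; simp
  rw [opC, dirQuot, map_mul, h2, Complex.conj_ofReal, ← h]; ring

theorem opC_add (A : Mat2) (z w : ℂ) : opC A (z + w) = opC A z + opC A w := by
  simp [opC]; ring

theorem opC_sub (A : Mat2) (z w : ℂ) : opC A (z - w) = opC A z - opC A w := by
  simp [opC]; ring

theorem opC_real_mul (A : Mat2) (r : ℝ) (z : ℂ) : opC A (r * z) = r * opC A z := by
  simp [opC]; ring

theorem continuous_holPart : Continuous holPart := by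
  unfold holPart; fun_prop

theorem continuous_antiPart : Continuous antiPart := by
  unfold antiPart; fun_prop

theorem continuous_dirQuot : Continuous fun p : Mat2 × ℝ => dirQuot p.1 p.2 := by
  unfold dirQuot
  have h1 : Continuous fun p : Mat2 × ℝ => holPart p.1 := continuous_holPart.comp continuous_fst
  have h2 : Continuous fun p : Mat2 × ℝ => antiPart p.1 := continuous_antiPart.comp continuous_fst
  fun_prop

/-- Opposite vectors have the same quotient, so all angular data live on the circle of directions
modulo `π`. -/
theorem dirQuot_add_pi (A : Mat2) (θ : ℝ) : dirQuot A (θ + Real.pi) = dirQuot A θ := by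
  unfold dirQuot
  have : (-(2 * (θ + Real.pi) : ℝ) * Complex.I : ℂ)
      = -(2 * θ : ℝ) * Complex.I - 2 * Real.pi * Complex.I := by push_cast; ring
  rw [this, Complex.exp_periodic.sub_eq]

theorem exists_opC_bound {𝒜 : Set Mat2} (h : IsCompact 𝒜) :
    ∃ M : ℝ, 0 < M ∧ (∀ A ∈ 𝒜, ∀ z, ‖opC A z‖ ≤ M * ‖z‖) ∧
      ∀ A ∈ 𝒜, ∀ θ, ‖dirQuot A θ‖ ≤ M := by
  obtain ⟨C, hC⟩ := h.exists_bound_of_continuousOn continuous_holPart.continuousOn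
  obtain ⟨D, hD⟩ := h.exists_bound_of_continuousOn continuous_antiPart.continuousOn
  refine ⟨|C| + |D| + 1, by positivity, fun A hA z => ?_, fun A hA θ => ?_⟩
  · have h1 := (hC A hA).trans (le_abs_self C)
    have h2 := (hD A hA).trans (le_abs_self D)
    calc ‖opC A z‖ ≤ ‖holPart A‖ * ‖z‖ + ‖antiPart A‖ * ‖z‖ := by
          unfold opC
          refine (norm_add_le _ _).trans ?_
          rw [norm_mul, norm_mul, RCLike.norm_conj]
      _ ≤ _ := by nlinarith [norm_nonneg z]
  · have h1 := (hC A hA).trans (le_abs_self C)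
    have h2 := (hD A hA).trans (le_abs_self D)
    calc ‖dirQuot A θ‖ ≤ ‖holPart A‖ + ‖antiPart A‖ * 1 := by
          unfold dirQuot
          refine (norm_add_le _ _).trans ?_
          rw [norm_mul, ← Complex.ofReal_neg, Complex.norm_exp_ofReal_mul_I]
      _ ≤ _ := by linarith

/-! ### Carathéodory trajectories: basic estimates and uniqueness -/

/-- Trajectories written in the complex coordinate. -/
structure PlaneTraj (𝒜 : Set Mat2) (A : ℝ → Mat2) (z : ℝ → ℂ) : Prop where
  measurable_law : ∀ i j, Measurable fun t => A t i j
  law_mem : ∀ t, 0 ≤ t → A t ∈ 𝒜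
  continuousOn : ContinuousOn z (Set.Ici 0)
  solves : ∀ t, 0 ≤ t → z t = z 0 + ∫ s in (0 : ℝ)..t, opC (A s) (z s)

theorem isTrajectory_iff {𝒜 : Set Mat2} {A : ℝ → Mat2} {x : ℝ → Vec2} :
    IsTrajectory 𝒜 A x ↔ PlaneTraj 𝒜 A (fun t => toC (x t)) := by
  have key : ∀ t, toC (x 0 + ∫ s in (0 : ℝ)..t, A s *ᵥ x s)
      = toC (x 0) + ∫ s in (0 : ℝ)..t, opC (A s) (toC (x s)) := by
    intro t
    rw [← toCL_apply, map_add]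
    congr 1
    rw [← ContinuousLinearEquiv.coe_coe, intervalIntegral.intervalIntegral_eq_integral_uIoc,
      intervalIntegral.intervalIntegral_eq_integral_uIoc, map_smul]
    congr 1
    rw [ContinuousLinearEquiv.coe_coe, ← ContinuousLinearEquiv.integral_comp_comm]
    simp only [toCL_apply, toC_mulVec]
  constructor
  · rintro ⟨h1, h2, h3, h4⟩
    refine ⟨h1, h2, toCL.continuous.comp_continuousOn h3, fun t ht => ?_⟩
    rw [← key, ← h4 t ht]
  · rintro ⟨h1, h2, h3, h4⟩
    refine ⟨h1, h2, ?_, fun t ht => toC_injective ?_⟩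
    · have := toCL.symm.continuous.comp_continuousOn h3
      refine this.congr fun t _ => ?_
      exact (toCL.symm_apply_apply (x t)).symm
    · rw [key]; exact h4 t ht

namespace PlaneTraj

variable {𝒜 : Set Mat2} {A : ℝ → Mat2} {z w : ℝ → ℂ} {M : ℝ}

theorem measurable_holPart (hz : PlaneTraj 𝒜 A z) : Measurable fun t => holPart (A t) := by
  have h := hz.measurable_law
  unfold holPart
  have h00 := h 0 0
  have h01 := h 0 1
  have h10 := h 1 0
  have h11 := h 1 1
  fun_prop

theorem measurable_antiPart (hz : PlaneTraj 𝒜 A z) : Measurable fun t => antiPart (A t) := by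
  have h := hz.measurable_law
  unfold antiPart
  have h00 := h 0 0
  have h01 := h 0 1
  have h10 := h 1 0
  have h11 := h 1 1
  fun_prop

theorem intervalIntegrable (hz : PlaneTraj 𝒜 A z) (hM : ∀ A ∈ 𝒜, ∀ z, ‖opC A z‖ ≤ M * ‖z‖)
    (hM0 : 0 < M) {y : ℝ → ℂ} (hy : ContinuousOn y (Ici 0)) {a b : ℝ} (ha : 0 ≤ a) (hb : 0 ≤ b) :
    IntervalIntegrable (fun s => opC (A s) (y s)) volume a b := by
  have hsub : uIcc a b ⊆ Ici 0 := fun s hs => (le_inf ha hb).trans hs.1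
  have hsub' : uIoc a b ⊆ Ici 0 := uIoc_subset_uIcc.trans hsub
  have hi : IntervalIntegrable (fun s => M * ‖y s‖) volume a b :=
    ((hy.mono hsub).norm.const_smul M).intervalIntegrable
  refine hi.mono_fun ?_ ?_
  · have hy' : AEStronglyMeasurable y (volume.restrict (uIoc a b)) :=
      (hy.mono hsub').aestronglyMeasurable measurableSet_uIoc
    unfold opC
    exact (hz.measurable_holPart.aestronglyMeasurable.mul hy').add
      (hz.measurable_antiPart.aestronglyMeasurable.mul
        (Complex.continuous_conj.comp_aestronglyMeasurable hy'))
  · refine (ae_restrict_mem measurableSet_uIoc).mono fun s hs => ?_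
    refine (hM _ (hz.law_mem s (hsub' hs)) _).trans (le_of_eq ?_)
    exact (Real.norm_of_nonneg (mul_nonneg hM0.le (norm_nonneg _))).symm

theorem sub_eq_integral (hz : PlaneTraj 𝒜 A z) (hM : ∀ A ∈ 𝒜, ∀ z, ‖opC A z‖ ≤ M * ‖z‖)
    (hM0 : 0 < M) {a b : ℝ} (ha : 0 ≤ a) (hb : 0 ≤ b) :
    z b - z a = ∫ s in a..b, opC (A s) (z s) := by
  rw [hz.solves b hb, hz.solves a ha,
    ← intervalIntegral.integral_interval_sub_left
      (hz.intervalIntegrable hM hM0 hz.continuousOn le_rfl hb)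
      (hz.intervalIntegrable hM hM0 hz.continuousOn le_rfl ha)]
  ring

theorem norm_sub_le (hz : PlaneTraj 𝒜 A z) (hM : ∀ A ∈ 𝒜, ∀ z, ‖opC A z‖ ≤ M * ‖z‖)
    (hM0 : 0 < M) {a b C : ℝ} (ha : 0 ≤ a) (hab : a ≤ b) (hC : ∀ s ∈ Icc a b, ‖z s‖ ≤ C) :
    ‖z b - z a‖ ≤ M * C * (b - a) := by
  rw [hz.sub_eq_integral hM hM0 ha (ha.trans hab)]
  have := intervalIntegral.norm_integral_le_of_norm_le_const (a := a) (b := b)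
    (f := fun s => opC (A s) (z s)) (C := M * C) ?_
  · rwa [abs_of_nonneg (by linarith)] at this
  · intro s hs
    rw [uIoc_of_le hab] at hs
    exact (hM _ (hz.law_mem s (ha.trans hs.1.le)) _).trans
      (mul_le_mul_of_nonneg_left (hC s ⟨hs.1.le, hs.2⟩) hM0.le)

theorem eqOn_of_initial_eq (hz : PlaneTraj 𝒜 A z) (hw : PlaneTraj 𝒜 A w)
    (hM : ∀ A ∈ 𝒜, ∀ z, ‖opC A z‖ ≤ M * ‖z‖) (hM0 : 0 < M) (h0 : z 0 = w 0) {t : ℝ}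
    (ht : 0 ≤ t) : z t = w t := by
  -- Freezing the argument at `max s 0` gives a function continuous on all of `ℝ`, so that its
  -- primitive is differentiable everywhere.
  set y : ℝ → ℝ := fun s => ‖z (max s 0) - w (max s 0)‖ with hy
  have hmax : ∀ f : ℝ → ℂ, ContinuousOn f (Ici 0) → Continuous fun s => f (max s 0) := by
    intro f hf
    exact hf.comp_continuous (by fun_prop) fun s => le_max_right s 0
  have hyc : Continuous y := ((hmax z hz.continuousOn).sub (hmax w hw.continuousOn)).norm
  have hle : ∀ s, 0 ≤ s → y s ≤ M * ∫ r in (0 : ℝ)..s, y r := by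
    intro s hs
    have e : z s - w s = ∫ r in (0 : ℝ)..s, opC (A r) (z r - w r) := by
      rw [hz.solves s hs, hw.solves s hs, h0, add_sub_add_left_eq_sub,
        ← intervalIntegral.integral_sub
          (hz.intervalIntegrable hM hM0 hz.continuousOn le_rfl hs)
          (hw.intervalIntegrable hM hM0 hw.continuousOn le_rfl hs)]
      simp only [opC_sub]
    simp only [hy, max_eq_left hs]
    rw [e, ← intervalIntegral.integral_const_mul]
    refine intervalIntegral.norm_integral_le_of_norm_le hs ?_
      ((hyc.const_smul M).intervalIntegrable _ _)
    refine Eventually.of_forall fun r hr => ?_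
    rw [max_eq_left hr.1.le]
    exact hM _ (hz.law_mem r hr.1.le) _
  set F : ℝ → ℝ := fun s => ∫ r in (0 : ℝ)..s, y r with hF
  have hFd : ∀ s, HasDerivAt F (y s) s := fun s =>
    intervalIntegral.integral_hasDerivAt_right (hyc.intervalIntegrable _ _)
      (hyc.stronglyMeasurableAtFilter _ _) hyc.continuousAt
  have hFnn : ∀ s, 0 ≤ s → 0 ≤ F s := fun s hs =>
    intervalIntegral.integral_nonneg hs fun r _ => norm_nonneg _
  -- Grönwall is applied to the primitive `F`, which is differentiable, with `F' = y ≤ M F`; then `F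
  -- = 0` forces `y = 0`.
  have hg := norm_le_gronwallBound_of_norm_deriv_right_le (f := F) (f' := y) (δ := 0) (K := M)
    (ε := 0) (a := 0) (b := t) (fun s _ => (hFd s).continuousAt.continuousWithinAt)
    (fun s _ => (hFd s).hasDerivWithinAt) (by simp [hF]) (by
      intro s hs
      rw [Real.norm_of_nonneg (norm_nonneg _), Real.norm_of_nonneg (hFnn s hs.1)]
      simpa using hle s hs.1) t ⟨ht, le_rfl⟩
  rw [gronwallBound_ε0_δ0] at hg
  have hFt : F t = 0 := norm_le_zero_iff.mp hg
  have := hle t ht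
  rw [show (∫ r in (0 : ℝ)..t, y r) = F t from rfl, hFt, mul_zero] at this
  simp only [hy, max_eq_left ht] at this
  exact sub_eq_zero.mp (norm_le_zero_iff.mp this)

theorem real_mul (hz : PlaneTraj 𝒜 A z) (c : ℝ) : PlaneTraj 𝒜 A (fun t => c * z t) := by
  refine ⟨hz.measurable_law, hz.law_mem, continuousOn_const.mul hz.continuousOn, fun t ht => ?_⟩
  simp only [opC_real_mul]
  rw [intervalIntegral.integral_const_mul, ← mul_add, ← hz.solves t ht]

theorem shift (hz : PlaneTraj 𝒜 A z) (hM : ∀ A ∈ 𝒜, ∀ z, ‖opC A z‖ ≤ M * ‖z‖) (hM0 : 0 < M)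
    {a : ℝ} (ha : 0 ≤ a) : PlaneTraj 𝒜 (fun t => A (a + t)) (fun t => z (a + t)) := by
  refine ⟨fun i j => ?_, fun t ht => hz.law_mem _ (by positivity), ?_, fun t ht => ?_⟩
  · exact (hz.measurable_law i j).comp (measurable_const_add a)
  · exact hz.continuousOn.comp (by fun_prop) fun t ht => add_nonneg ha ht
  · have := hz.sub_eq_integral hM hM0 ha (add_nonneg ha ht)
    rw [intervalIntegral.integral_comp_add_left (fun s => opC (A s) (z s)), add_zero, ← this]
    ring

end PlaneTraj

/-! ### Lyapunov functions; stability from a slope field -/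

namespace PlaneTraj

variable {𝒜 : Set Mat2} {A : ℝ → Mat2} {z w : ℝ → ℂ} {M : ℝ}

/-- A strict Lyapunov function decreases exponentially along trajectories. -/
theorem le_exp_of_lyapunov (hz : PlaneTraj 𝒜 A z) (hM : ∀ A ∈ 𝒜, ∀ z, ‖opC A z‖ ≤ M * ‖z‖)
    (hM0 : 0 < M) {W : ℂ → ℝ} {W' : ℂ → ℂ →L[ℝ] ℝ} {ε : ℝ} (hε : 0 < ε)
    (hW : ∀ u, HasFDerivAt W (W' u) u) (hdec : ∀ A ∈ 𝒜, ∀ u, W' u (opC A u) ≤ -ε * W u)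
    {K t : ℝ} (hK : 0 < K) (h0 : W (z 0) ≤ K) (ht : 0 ≤ t) :
    W (z t) ≤ K * Real.exp (-(ε / 2) * t) := by
  have hWc : Continuous W := continuous_iff_continuousAt.2 fun u => (hW u).continuousAt
  have hB : ∀ s : ℝ, HasDerivAt (fun s => K * Real.exp (-(ε / 2) * s))
      (-(ε / 2) * (K * Real.exp (-(ε / 2) * s))) s := by
    intro s
    have := (((hasDerivAt_id s).const_mul (-(ε / 2))).exp).const_mul K
    refine this.congr_deriv ?_
    simp only [id]
    ring
  -- `W ∘ z` need not be differentiable, so it is compared with the exponential through right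
  -- slopes. The halved rate `ε / 2` makes the inequality of derivatives strict wherever the two
  -- functions meet.
  refine image_le_of_liminf_slope_right_lt_deriv_boundary' (f := fun s => W (z s))
    (f' := fun s => -ε * W (z s)) (a := 0) (b := t)
    (hWc.comp_continuousOn (hz.continuousOn.mono fun s hs => hs.1)) ?_ (by simpa using h0)
    (fun s _ => (hB s).continuousAt.continuousWithinAt) (fun s _ => (hB s).hasDerivWithinAt) ?_
    ⟨ht, le_rfl⟩
  · intro s hs r hr
    have hs0 : 0 ≤ s := hs.1
    set ℓ := W' (z s)
    -- A third of the gap pays for freezing `z` at time `s`, a third for the Taylor remainder of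
    -- `W`; the last keeps the inequality strict.
    set η := (r + ε * W (z s)) / 3 with hη
    have hηpos : 0 < η := by rw [hη]; linarith
    obtain ⟨κ, hκ, hκ'⟩ : ∃ κ : ℝ, 0 < κ ∧ ‖ℓ‖ * M * κ ≤ η := by
      refine ⟨η / (‖ℓ‖ * M + 1), by positivity, ?_⟩
      rw [← mul_div_assoc, div_le_iff₀ (by positivity)]
      nlinarith [norm_nonneg ℓ]
    have hcont : Tendsto z (𝓝[>] s) (𝓝 (z s)) :=
      ((hz.continuousOn s hs0).mono (fun u hu => hs0.trans (le_of_lt hu))).tendsto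
    have h1 : ∀ᶠ u in 𝓝[>] s, ∀ v ∈ Icc s u, ‖z v - z s‖ < κ := by
      have hci : Tendsto z (𝓝[≥] s) (𝓝 (z s)) :=
        ((hz.continuousOn s hs0).mono (fun u hu => hs0.trans hu)).tendsto
      have := hci.eventually (Metric.ball_mem_nhds (z s) hκ)
      obtain ⟨u, hu, hsub⟩ := (mem_nhdsGE_iff_exists_Ico_subset).1 this
      filter_upwards [Ioo_mem_nhdsGT hu] with v hv x hx
      have := hsub ⟨hx.1, hx.2.trans_lt hv.2⟩
      simpa [dist_eq_norm] using this
    set C := ‖z s‖ + κ with hC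
    have hCpos : 0 < C := by positivity
    have h2 : ∀ᶠ u in 𝓝[>] s, |W (z u) - W (z s) - ℓ (z u - z s)| ≤
        η / (M * C) * ‖z u - z s‖ := by
      have := ((hW (z s)).isLittleO.bound (show 0 < η / (M * C) by positivity))
      exact hcont.eventually this
    refine Eventually.frequently ?_
    filter_upwards [h1, h2, self_mem_nhdsWithin] with u hu1 hu2 hu3
    have hsu : s < u := hu3
    have hu0 : 0 ≤ u := hs0.trans hsu.le
    have hb : ‖z u - z s‖ ≤ M * C * (u - s) := by
      refine hz.norm_sub_le hM hM0 hs0 hsu.le fun v hv => ?_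
      have := norm_add_le (z s) (z v - z s)
      rw [add_sub_cancel] at this
      linarith [hu1 v hv]
    have hℓ : ℓ (z u - z s) ≤ (-ε * W (z s) + η) * (u - s) := by
      rw [hz.sub_eq_integral hM hM0 hs0 hu0, ← ContinuousLinearMap.intervalIntegral_comp_comm _
        (hz.intervalIntegrable hM hM0 hz.continuousOn hs0 hu0)]
      have hint : IntervalIntegrable (fun v => ℓ (opC (A v) (z v))) volume s u := by
        have := hz.intervalIntegrable hM hM0 hz.continuousOn hs0 hu0
        exact ⟨ℓ.integrable_comp this.1, ℓ.integrable_comp this.2⟩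
      have := intervalIntegral.integral_mono_on (g := fun _ => -ε * W (z s) + η) hsu.le hint
        intervalIntegrable_const ?_
      · refine this.trans (le_of_eq ?_)
        simp; ring
      · intro v hv
        have hmem := hz.law_mem v (hs0.trans hv.1)
        have e : opC (A v) (z v) = opC (A v) (z s) + opC (A v) (z v - z s) := by
          rw [opC_sub]; ring
        rw [e, map_add]
        refine add_le_add (hdec _ hmem _) ?_
        calc ℓ (opC (A v) (z v - z s)) ≤ ‖ℓ‖ * ‖opC (A v) (z v - z s)‖ :=
              (le_abs_self _).trans (ℓ.le_opNorm _)
          _ ≤ ‖ℓ‖ * (M * κ) := by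
              refine mul_le_mul_of_nonneg_left ?_ (norm_nonneg _)
              exact (hM _ hmem _).trans (mul_le_mul_of_nonneg_left (hu1 v hv).le hM0.le)
          _ ≤ η := by rw [← mul_assoc]; exact hκ'
    have hfin : W (z u) - W (z s) ≤ (-ε * W (z s) + 2 * η) * (u - s) := by
      have h3 := (abs_le.1 hu2).2
      have h4 : η / (M * C) * ‖z u - z s‖ ≤ η * (u - s) := by
        calc η / (M * C) * ‖z u - z s‖ ≤ η / (M * C) * (M * C * (u - s)) :=
              mul_le_mul_of_nonneg_left hb (by positivity)
          _ = η * (u - s) := by field_simp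
      linarith
    rw [slope_def_field, div_lt_iff₀ (sub_pos.2 hsu)]
    refine hfin.trans_lt (mul_lt_mul_of_pos_right ?_ (sub_pos.2 hsu))
    rw [hη]; linarith
  · intro s hs he
    have : 0 < K * Real.exp (-(ε / 2) * s) := by positivity
    simp only [he]
    nlinarith

theorem tendsto_zero_of_lyapunov (hz : PlaneTraj 𝒜 A z)
    (hM : ∀ A ∈ 𝒜, ∀ z, ‖opC A z‖ ≤ M * ‖z‖)
    (hM0 : 0 < M) {W : ℂ → ℝ} {W' : ℂ → ℂ →L[ℝ] ℝ} {ε c : ℝ} (hε : 0 < ε) (hc : 0 < c)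
    (hW : ∀ u, HasFDerivAt W (W' u) u) (hdec : ∀ A ∈ 𝒜, ∀ u, W' u (opC A u) ≤ -ε * W u)
    (hpos : ∀ u, c * ‖u‖ ^ 2 ≤ W u) : Tendsto z atTop (𝓝 0) := by
  have hW0 : 0 ≤ W (z 0) := le_trans (by positivity) (hpos (z 0))
  have hle : ∀ t, 0 ≤ t → ‖z t‖ ^ 2 ≤ (W (z 0) + 1) / c * Real.exp (-(ε / 2) * t) := by
    intro t ht
    -- The added `1` keeps the constant positive when `W (z 0) = 0`.
    have := hz.le_exp_of_lyapunov hM hM0 hε hW hdec (K := W (z 0) + 1) (by linarith)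
      (by linarith) ht
    rw [div_mul_eq_mul_div, le_div_iff₀ hc]
    linarith [hpos (z t)]
  have hlim : Tendsto (fun t : ℝ => (W (z 0) + 1) / c * Real.exp (-(ε / 2) * t)) atTop (𝓝 0) := by
    have h0 := mul_zero ((W (z 0) + 1) / c)
    conv => rhs; rw [← h0]
    refine Tendsto.const_mul _ (Real.tendsto_exp_atBot.comp ?_)
    exact tendsto_id.const_mul_atTop_of_neg (by linarith)
  have hsq : Tendsto (fun t => ‖z t‖ ^ 2) atTop (𝓝 0) :=
    squeeze_zero' (Eventually.of_forall fun t => by positivity)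
      ((eventually_ge_atTop 0).mono hle) hlim
  rw [tendsto_zero_iff_norm_tendsto_zero]
  have := hsq.sqrt
  simpa [Real.sqrt_sq (norm_nonneg _)] using this

end PlaneTraj

/-- The derivative of `log` as a real linear map. -/
theorem hasFDerivAt_log_div {a : ℂ} (ha : a ≠ 0) :
    HasFDerivAt (fun u : ℂ => Complex.log (u / a))
      ((ContinuousLinearMap.toSpanSingleton ℂ (1 / a : ℂ)).restrictScalars ℝ) a := by
  have h1 : HasDerivAt (fun u : ℂ => u / a) (1 / a) a := (hasDerivAt_id a).div_const a
  have h2 : HasDerivAt (fun u : ℂ => Complex.log (u / a)) (1 / a / (a / a)) a :=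
    h1.clog (by rw [div_self ha]; exact Complex.one_mem_slitPlane)
  rw [div_self ha, div_one] at h2
  exact h2.hasFDerivAt.restrictScalars ℝ

/-- A continuous slope field `g` of mean zero which strictly dominates the system gives stability. -/
theorem stable_of_slope {𝒜 : Set Mat2} (hcompact : IsCompact 𝒜) {g : ℝ → ℝ} (hg : Continuous g)
    (hper : Function.Periodic g Real.pi) (hint : ∫ θ in (0 : ℝ)..Real.pi, g θ = 0)
    (hlt : ∀ A ∈ 𝒜, ∀ θ, (dirQuot A θ).re - g θ * (dirQuot A θ).im < 0) : StableSystem 𝒜 := by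
  obtain ⟨M, hM0, hM, -⟩ := exists_opC_bound hcompact
  intro A x hx
  have hz := isTrajectory_iff.1 hx
  have hmem0 := hz.law_mem 0 le_rfl
  -- the uniform rate
  obtain ⟨ε, hε, hεle⟩ : ∃ ε : ℝ, 0 < ε ∧ ∀ A ∈ 𝒜, ∀ θ,
      (dirQuot A θ).re - g θ * (dirQuot A θ).im ≤ -ε := by
    have hcont : Continuous fun p : Mat2 × ℝ =>
        (dirQuot p.1 p.2).re - g p.2 * (dirQuot p.1 p.2).im := by
      have := continuous_dirQuot
      fun_prop
    obtain ⟨p, hp, hmax⟩ := (hcompact.prod (isCompact_Icc (a := (0 : ℝ)) (b := Real.pi)))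
      |>.exists_isMaxOn ⟨(A 0, 0), hmem0, by simp [Real.pi_pos.le]⟩ hcont.continuousOn
    refine ⟨-((dirQuot p.1 p.2).re - g p.2 * (dirQuot p.1 p.2).im),
      by linarith [hlt p.1 hp.1 p.2], fun B hB θ => ?_⟩
    have hP : Function.Periodic (fun θ => (dirQuot B θ).re - g θ * (dirQuot B θ).im) Real.pi := by
      intro θ
      simp only [dirQuot_add_pi, hper θ]
    obtain ⟨y, hy, hey⟩ := hP.exists_mem_Ico₀ Real.pi_pos θ
    rw [hey, neg_neg]
    exact hmax (a := (B, y)) ⟨hB, hy.1, hy.2.le⟩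
  -- Mean zero over a period is what makes the primitive `G` periodic, hence a function of the
  -- direction.
  set G : ℝ → ℝ := fun θ => ∫ s in (0 : ℝ)..θ, g s with hG
  have hGd : ∀ θ, HasDerivAt G (g θ) θ := fun θ =>
    intervalIntegral.integral_hasDerivAt_right (hg.intervalIntegrable _ _)
      (hg.stronglyMeasurableAtFilter _ _) hg.continuousAt
  have hGper : Function.Periodic G Real.pi := by
    intro θ
    have h1 : (∫ s in (0 : ℝ)..θ, g s) + ∫ s in θ..(θ + Real.pi), g s = G (θ + Real.pi) :=
      intervalIntegral.integral_add_adjacent_intervals (hg.intervalIntegrable _ _)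
        (hg.intervalIntegrable _ _)
    rw [← h1, hper.intervalIntegral_add_eq θ 0, zero_add, hint, add_zero]
  have hGper2 : Function.Periodic G (2 * Real.pi) := by
    simpa using hGper.nsmul 2
  have hGcont : Continuous G := continuous_iff_continuousAt.2 fun θ => (hGd θ).continuousAt
  obtain ⟨K, hK⟩ : ∃ K, ∀ θ, G θ ≤ K := by
    obtain ⟨K, hK⟩ := (isCompact_Icc (a := (0 : ℝ)) (b := Real.pi)).exists_bound_of_continuousOn
      hGcont.continuousOn
    refine ⟨K, fun θ => ?_⟩
    obtain ⟨y, hy, hey⟩ := hGper.exists_mem_Ico₀ Real.pi_pos θ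
    rw [hey]
    exact (le_abs_self _).trans (hK y ⟨hy.1, hy.2.le⟩)
  obtain ⟨K', hK'⟩ : ∃ K, ∀ θ, -K ≤ G θ := by
    obtain ⟨K, hK⟩ := (isCompact_Icc (a := (0 : ℝ)) (b := Real.pi)).exists_bound_of_continuousOn
      hGcont.continuousOn
    refine ⟨K, fun θ => ?_⟩
    obtain ⟨y, hy, hey⟩ := hGper.exists_mem_Ico₀ Real.pi_pos θ
    rw [hey]
    exact (abs_le.1 (hK y ⟨hy.1, hy.2.le⟩)).1
  -- `log W = 2 (log r - G θ)`, with derivative `2 (Re q - g θ * Im q) ≤ -2ε` along the flow.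
  set W : ℂ → ℝ := fun u => ‖u‖ ^ 2 * Real.exp (-(2 * G u.arg)) with hWdef
  -- local formula
  have hloc : ∀ a u : ℂ, a ≠ 0 → u ≠ 0 → W u = ‖a‖ ^ 2 *
      Real.exp (2 * ((Complex.log (u / a)).re - G (a.arg + (Complex.log (u / a)).im))) := by
    intro a u ha hu
    -- Arguments add only modulo `2π`; periodicity of `G` absorbs the defect and removes the branch
    -- cut of `arg` from `W`.
    have h1 : G (a.arg + (u / a).arg) = G u.arg := by
      have h := Complex.arg_mul_coe_angle ha (div_ne_zero hu ha)
      rw [mul_div_cancel₀ _ ha, ← Real.Angle.coe_add, Real.Angle.angle_eq_iff_two_pi_dvd_sub] at h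
      obtain ⟨k, hk⟩ := h
      have : u.arg = a.arg + (u / a).arg + k * (2 * Real.pi) := by linarith
      rw [this]
      exact ((hGper2.int_mul k) _).symm
    have hn : (0 : ℝ) < ‖a‖ := norm_pos_iff.2 ha
    have hn' : (0 : ℝ) < ‖u‖ := norm_pos_iff.2 hu
    rw [Complex.log_re, Complex.log_im, h1, mul_sub, Real.exp_sub, hWdef]
    have : Real.exp (2 * Real.log ‖u / a‖) = (‖u‖ / ‖a‖) ^ 2 := by
      rw [two_mul, Real.exp_add, Real.exp_log (by rw [norm_div]; positivity), norm_div, sq]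
    rw [this]
    simp only [Real.exp_neg]
    field_simp
  set W' : ℂ → ℂ →L[ℝ] ℝ := fun a => (2 * W a) •
    ((Complex.reCLM - g a.arg • Complex.imCLM).comp
      ((ContinuousLinearMap.toSpanSingleton ℂ (1 / a : ℂ)).restrictScalars ℝ)) with hW'def
  have hW0 : W 0 = 0 := by simp [hWdef]
  have hWd : ∀ a, HasFDerivAt W (W' a) a := by
    intro a
    by_cases ha : a = 0
    · subst ha
      have : W' 0 = 0 := by simp [hW'def, hW0]
      rw [this, hasFDerivAt_iff_isLittleO_nhds_zero]
      simp only [zero_add, hW0, _root_.zero_apply, sub_zero]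
      -- Since `G` is bounded below, `W` is quadratically small at the origin, so its derivative
      -- there is zero although `arg` is singular.
      have hO : (W : ℂ → ℝ) =O[𝓝 0] fun u : ℂ => ‖u‖ ^ 2 := by
        refine Asymptotics.IsBigO.of_bound (Real.exp (2 * K')) (Eventually.of_forall fun u => ?_)
        rw [hWdef, norm_mul, mul_comm]
        refine mul_le_mul_of_nonneg_right ?_ (norm_nonneg _)
        rw [Real.norm_of_nonneg (Real.exp_pos _).le]
        exact Real.exp_le_exp.2 (by linarith [hK' u.arg])
      refine hO.trans_isLittleO ?_
      have := Asymptotics.isLittleO_norm_pow_id (E' := ℂ) (n := 2) (by norm_num)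
      exact this
    · set L := ((ContinuousLinearMap.toSpanSingleton ℂ (1 / a : ℂ)).restrictScalars ℝ)
      have hlog := hasFDerivAt_log_div ha
      have hre : HasFDerivAt (fun u : ℂ => (Complex.log (u / a)).re) (Complex.reCLM.comp L) a :=
        Complex.reCLM.hasFDerivAt.comp a hlog
      have him : HasFDerivAt (fun u : ℂ => a.arg + (Complex.log (u / a)).im)
          (Complex.imCLM.comp L) a :=
        (Complex.imCLM.hasFDerivAt.comp a hlog).const_add _
      have hbase : a.arg + (Complex.log (a / a)).im = a.arg := by
        rw [div_self ha, Complex.log_one]; simp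
      have hGc : HasFDerivAt (fun u : ℂ => G (a.arg + (Complex.log (u / a)).im))
          (g a.arg • Complex.imCLM.comp L) a := by
        have h := hGd a.arg
        rw [← hbase] at h
        have := h.comp_hasFDerivAt a him
        rw [hbase] at this
        exact this
      have htot := (((hre.sub hGc).const_mul 2).exp).const_mul (‖a‖ ^ 2)
      have hev : W =ᶠ[𝓝 a] fun u => ‖a‖ ^ 2 * Real.exp (2 *
          ((Complex.log (u / a)).re - G (a.arg + (Complex.log (u / a)).im))) := by
        filter_upwards [isOpen_ne.mem_nhds ha] with u hu using hloc a u ha hu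
      refine (htot.congr_of_eventuallyEq hev).congr_fderiv ?_
      have hWa := hloc a a ha ha
      ext v
      simp only [hW'def, _root_.smul_apply, ContinuousLinearMap.comp_apply,
        _root_.sub_apply, smul_eq_mul, hWa]
      simp only [Pi.sub_apply]
      ring
  have hWdec : ∀ A ∈ 𝒜, ∀ u, W' u (opC A u) ≤ -(2 * ε) * W u := by
    intro B hB u
    by_cases hu : u = 0
    · subst hu; simp [hW'def, hW0]
    · have e : opC B u / u = dirQuot B u.arg := by
        rw [div_eq_iff hu]
        conv_lhs => rw [← Complex.norm_mul_exp_arg_mul_I u]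
        rw [opC_polar, Complex.norm_mul_exp_arg_mul_I]
      have hv : W' u (opC B u) = 2 * W u * ((dirQuot B u.arg).re
          - g u.arg * (dirQuot B u.arg).im) := by
        rw [← e]
        simp [hW'def, div_eq_mul_inv]
      rw [hv]
      have hWn : 0 ≤ W u := by positivity
      nlinarith [hεle B hB u.arg]
  have hpos : ∀ u, Real.exp (-(2 * K)) * ‖u‖ ^ 2 ≤ W u := by
    intro u
    rw [mul_comm]
    refine mul_le_mul_of_nonneg_left (Real.exp_le_exp.2 ?_) (by positivity)
    linarith [hK u.arg]
  have hT := hz.tendsto_zero_of_lyapunov hM hM0 (by linarith : 0 < 2 * ε) (Real.exp_pos _) hWd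
    hWdec hpos
  have := (toCL.symm.continuous.tendsto 0).comp hT
  rw [map_zero] at this
  refine this.congr fun t => ?_
  exact toCL.symm_apply_apply (x t)

/-! ### Existence of solutions for measurable laws -/

theorem PlaneTraj.zero {𝒜 : Set Mat2} {A : ℝ → Mat2} (hA : ∀ i j, Measurable fun t => A t i j)
    (hmem : ∀ t, 0 ≤ t → A t ∈ 𝒜) : PlaneTraj 𝒜 A (fun _ => 0) :=
  ⟨hA, hmem, continuousOn_const, fun t _ => by simp [opC]⟩

/-- Carathéodory solutions of the linear system exist for every measurable law. -/
theorem exists_planeTraj {𝒜 : Set Mat2} {M : ℝ} (hM : ∀ A ∈ 𝒜, ∀ z, ‖opC A z‖ ≤ M * ‖z‖)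
    (hM0 : 0 < M) {A : ℝ → Mat2} (hA : ∀ i j, Measurable fun t => A t i j)
    (hmem : ∀ t, A t ∈ 𝒜) (z₀ : ℂ) :
    ∃ z, PlaneTraj 𝒜 A z ∧ z 0 = z₀ ∧
      ∀ t, 0 ≤ t → ‖z t‖ ≤ 2 * ‖z₀‖ * Real.exp (2 * M * t) := by
  have hz0 := PlaneTraj.zero hA (𝒜 := 𝒜) (fun t _ => hmem t)
  -- Substituting `z = e^{2Mt} u` turns the Picard operator into a contraction of ratio `1/2` on
  -- bounded continuous functions, so one fixed point serves all times. Negative times are frozen by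
  -- `max t 0`.
  set f : (ℝ → ℂ) → ℝ → ℂ := fun u s => (Real.exp (2 * M * s) : ℂ) * opC (A s) (u s) with hf
  have hfint : ∀ u : ℝ → ℂ, Continuous u → ∀ a b, IntervalIntegrable (f u) volume a b := by
    intro u hu a b
    have hi : IntervalIntegrable (fun s => Real.exp (2 * M * s) * (M * ‖u s‖)) volume a b := by
      apply Continuous.intervalIntegrable; fun_prop
    refine hi.mono_fun ?_ (Eventually.of_forall fun s => ?_)
    · have he : Continuous fun s : ℝ => (Real.exp (2 * M * s) : ℂ) := by fun_prop
      refine he.aestronglyMeasurable.mul ?_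
      exact (hz0.measurable_holPart.aestronglyMeasurable.mul hu.aestronglyMeasurable).add
        (hz0.measurable_antiPart.aestronglyMeasurable.mul
          (Complex.continuous_conj.comp_aestronglyMeasurable hu.aestronglyMeasurable))
    · simp only [hf]
      rw [norm_mul, Complex.norm_real, norm_mul]
      refine mul_le_mul_of_nonneg_left ?_ (norm_nonneg _)
      exact (hM _ (hmem s) _).trans (le_abs_self _)
  have hexp : ∀ t : ℝ, ∫ s in (0 : ℝ)..t, Real.exp (2 * M * s)
      = (Real.exp (2 * M * t) - 1) / (2 * M) := by
    intro t
    have hd : ∀ s ∈ uIcc 0 t, HasDerivAt (fun s => Real.exp (2 * M * s) / (2 * M))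
        (Real.exp (2 * M * s)) s := by
      intro s _
      have := (((hasDerivAt_id s).const_mul (2 * M)).exp).div_const (2 * M)
      refine this.congr_deriv ?_
      simp only [id, mul_one]
      field_simp
    rw [intervalIntegral.integral_eq_sub_of_hasDerivAt hd
      (by apply Continuous.intervalIntegrable; fun_prop)]
    simp; ring
  have hbound : ∀ (u : ℝ → ℂ) (N : ℝ), 0 ≤ N → (∀ s, ‖u s‖ ≤ N) → ∀ t, 0 ≤ t →
      ‖∫ s in (0 : ℝ)..t, f u s‖ ≤ N / 2 * Real.exp (2 * M * t) := by
    intro u N hN hu t ht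
    have h1 : ‖∫ s in (0 : ℝ)..t, f u s‖ ≤ ∫ s in (0 : ℝ)..t, M * N * Real.exp (2 * M * s) := by
      refine intervalIntegral.norm_integral_le_of_norm_le ht (Eventually.of_forall fun s _ => ?_)
        (by apply Continuous.intervalIntegrable; fun_prop)
      rw [hf, norm_mul, Complex.norm_real, Real.norm_of_nonneg (Real.exp_pos _).le, mul_comm]
      refine mul_le_mul_of_nonneg_right ?_ (Real.exp_pos _).le
      exact (hM _ (hmem s) _).trans (mul_le_mul_of_nonneg_left (hu s) hM0.le)
    refine h1.trans ?_
    rw [intervalIntegral.integral_const_mul, hexp]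
    have : M * N * ((Real.exp (2 * M * t) - 1) / (2 * M))
        = N / 2 * (Real.exp (2 * M * t) - 1) := by field_simp
    rw [this]
    nlinarith
  have hexple : ∀ t : ℝ, Real.exp (-(2 * M * t)) * Real.exp (2 * M * t) = 1 := fun t => by
    rw [← Real.exp_add]; simp
  set Φ : (ℝ → ℂ) → ℝ → ℂ := fun u t => (Real.exp (-(2 * M * max t 0)) : ℂ) *
    (z₀ + ∫ s in (0 : ℝ)..max t 0, f u s) with hΦ
  have hΦbound : ∀ (u : ℝ → ℂ) (N : ℝ), 0 ≤ N → (∀ s, ‖u s‖ ≤ N) → ∀ t,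
      ‖Φ u t‖ ≤ ‖z₀‖ + N / 2 := by
    intro u N hN hu t
    have ht : 0 ≤ max t 0 := le_max_right _ _
    rw [hΦ, norm_mul, Complex.norm_real, Real.norm_of_nonneg (Real.exp_pos _).le]
    have h1 := norm_add_le z₀ (∫ s in (0 : ℝ)..max t 0, f u s)
    have h2 := hbound u N hN hu _ ht
    have h3 : Real.exp (-(2 * M * max t 0)) ≤ 1 := Real.exp_le_one_iff.2 (by
      have := mul_nonneg hM0.le ht; linarith)
    have h4 := hexple (max t 0)
    calc _ ≤ Real.exp (-(2 * M * max t 0)) * (‖z₀‖ + N / 2 * Real.exp (2 * M * max t 0)) :=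
          mul_le_mul_of_nonneg_left (by linarith) (Real.exp_pos _).le
      _ = Real.exp (-(2 * M * max t 0)) * ‖z₀‖
          + N / 2 * (Real.exp (-(2 * M * max t 0)) * Real.exp (2 * M * max t 0)) := by ring
      _ ≤ _ := by rw [h4]; nlinarith [norm_nonneg z₀]
  have hΦcont : ∀ u : ℝ → ℂ, Continuous u → Continuous (Φ u) := by
    intro u hu
    have := intervalIntegral.continuous_primitive (hfint u hu) 0
    have h2 : Continuous fun t : ℝ => ∫ s in (0 : ℝ)..max t 0, f u s :=
      this.comp (continuous_id.max continuous_const)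
    have h3 : Continuous fun t : ℝ => (Real.exp (-(2 * M * max t 0)) : ℂ) := by fun_prop
    exact h3.mul (continuous_const.add h2)
  set Ψ : BoundedContinuousFunction ℝ ℂ → BoundedContinuousFunction ℝ ℂ := fun u =>
    BoundedContinuousFunction.ofNormedAddCommGroup (Φ u) (hΦcont u u.continuous)
      (‖z₀‖ + ‖u‖ / 2) (hΦbound u ‖u‖ (norm_nonneg _) u.norm_coe_le_norm) with hΨ
  have hcontr : ContractingWith (1 / 2) Ψ := by
    refine ⟨by rw [← NNReal.coe_lt_coe]; norm_num, LipschitzWith.of_dist_le_mul fun u v => ?_⟩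
    rw [BoundedContinuousFunction.dist_le (by positivity)]
    intro t
    have ht : 0 ≤ max t 0 := le_max_right _ _
    have e : Ψ u t - Ψ v t = (Real.exp (-(2 * M * max t 0)) : ℂ) *
        ∫ s in (0 : ℝ)..max t 0, f (fun s => u s - v s) s := by
      have : (∫ s in (0 : ℝ)..max t 0, f (fun s => u s - v s) s) =
          (∫ s in (0 : ℝ)..max t 0, f u s) - ∫ s in (0 : ℝ)..max t 0, f v s := by
        rw [← intervalIntegral.integral_sub (hfint u u.continuous _ _) (hfint v v.continuous _ _)]
        simp only [hf, opC_sub, mul_sub]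
      rw [this]
      simp only [hΨ, hΦ, BoundedContinuousFunction.coe_ofNormedAddCommGroup]
      ring
    rw [dist_eq_norm, e, norm_mul, Complex.norm_real, Real.norm_of_nonneg (Real.exp_pos _).le]
    have h2 := hbound (fun s => u s - v s) (dist u v) dist_nonneg (fun s => by
      rw [← dist_eq_norm]; exact BoundedContinuousFunction.dist_coe_le_dist s) _ ht
    calc _ ≤ Real.exp (-(2 * M * max t 0)) * (dist u v / 2 * Real.exp (2 * M * max t 0)) :=
          mul_le_mul_of_nonneg_left h2 (Real.exp_pos _).le
      _ = dist u v / 2 * (Real.exp (-(2 * M * max t 0)) * Real.exp (2 * M * max t 0)) := by ring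
      _ = _ := by rw [hexple]; push_cast; ring
  set u := hcontr.fixedPoint Ψ
  have hu : Ψ u = u := hcontr.fixedPoint_isFixedPt
  have hut : ∀ t, u t = Φ u t := fun t => by
    conv_lhs => rw [← hu]
    rfl
  have hunorm : ‖u‖ ≤ 2 * ‖z₀‖ := by
    have : ‖u‖ ≤ ‖z₀‖ + ‖u‖ / 2 := by
      rw [BoundedContinuousFunction.norm_le (by positivity)]
      intro t
      rw [hut]
      exact hΦbound u ‖u‖ (norm_nonneg _) u.norm_coe_le_norm t
    linarith
  have hsolve : ∀ t, 0 ≤ t → (Real.exp (2 * M * t) : ℂ) * u t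
      = z₀ + ∫ s in (0 : ℝ)..t, opC (A s) ((Real.exp (2 * M * s) : ℂ) * u s) := by
    intro t ht
    simp only [opC_real_mul]
    rw [hut t]
    simp only [hΦ, max_eq_left ht]
    rw [← mul_assoc, ← Complex.ofReal_mul, mul_comm (Real.exp (2 * M * t)), hexple]
    simp [hf]
  have hzero : (Real.exp (2 * M * 0) : ℂ) * u 0 = z₀ := by
    rw [hsolve 0 le_rfl]; simp
  refine ⟨fun t => (Real.exp (2 * M * t) : ℂ) * u t, ⟨hA, fun t _ => hmem t, ?_, fun t ht => ?_⟩,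
    hzero, fun t _ => ?_⟩
  · have := u.continuous
    exact Continuous.continuousOn (by fun_prop)
  · rw [hzero]; exact hsolve t ht
  · rw [norm_mul, Complex.norm_real, Real.norm_of_nonneg (Real.exp_pos _).le, mul_comm]
    exact mul_le_mul_of_nonneg_right ((u.norm_coe_le_norm t).trans hunorm) (Real.exp_pos _).le

/-! ### Stability excludes nonnegative eigenvalues in the hull -/

/-- Every matrix of the convex hull is the mean of a measurable law. -/
theorem exists_law_of_mem_convexHull {𝒜 : Set Mat2} (hcompact : IsCompact 𝒜) {B : Mat2}
    (hB : B ∈ convexHull ℝ 𝒜) :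
    ∃ α : ℝ → Mat2, (∀ i j, Measurable fun t => α t i j) ∧ (∀ t, α t ∈ 𝒜) ∧
      ∀ i j, ∫ t in (0 : ℝ)..1, α t i j = B i j := by
  have hint : ∀ α : ℝ → Mat2, (∀ i j, Measurable fun t => α t i j) → (∀ t, α t ∈ 𝒜) →
      ∀ i j a b, IntervalIntegrable (fun t => α t i j) volume a b := by
    intro α hα hmem i j a b
    have hc : Continuous fun A : Mat2 => A i j := by fun_prop
    obtain ⟨C, hC⟩ := hcompact.exists_bound_of_continuousOn hc.continuousOn
    exact (intervalIntegrable_const (c := C)).mono_fun (hα i j).aestronglyMeasurable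
      (Eventually.of_forall fun t => (hC _ (hmem t)).trans (le_abs_self C))
  have hconv : Convex ℝ {B : Mat2 | ∃ α : ℝ → Mat2, (∀ i j, Measurable fun t => α t i j) ∧
      (∀ t, α t ∈ 𝒜) ∧ ∀ i j, ∫ t in (0 : ℝ)..1, α t i j = B i j} := by
    rintro B₁ ⟨α₁, hm₁, ha₁, hi₁⟩ B₂ ⟨α₂, hm₂, ha₂, hi₂⟩ a b ha hb hab
    rcases ha.eq_or_lt with rfl | ha'
    · have : b = 1 := by linarith
      subst this
      exact ⟨α₂, hm₂, ha₂, fun i j => by simp [hi₂]⟩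
    rcases hb.eq_or_lt with rfl | hb'
    · have : a = 1 := by linarith
      subst this
      exact ⟨α₁, hm₁, ha₁, fun i j => by simp [hi₁]⟩
    -- Play the first law compressed into `[0, a]` and the second compressed into `(a, 1]`: the mean
    -- becomes `a B₁ + b B₂`. The rescaling divides by `a` and `b`, whence the separate degenerate
    -- cases.
    set α : ℝ → Mat2 := fun t => if t ≤ a then α₁ (t / a) else α₂ ((t - a) / b) with hα
    have hαm : ∀ i j, Measurable fun t => α t i j := by
      intro i j
      have : (fun t => α t i j) = fun t => if t ≤ a then α₁ (t / a) i j
          else α₂ ((t - a) / b) i j := by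
        funext t; simp only [hα]; split_ifs <;> rfl
      rw [this]
      exact Measurable.ite measurableSet_Iic ((hm₁ i j).comp (measurable_id.div_const a))
        ((hm₂ i j).comp ((measurable_id.sub_const a).div_const b))
    have hαmem : ∀ t, α t ∈ 𝒜 := by
      intro t; simp only [hα]; split_ifs
      exacts [ha₁ _, ha₂ _]
    refine ⟨α, hαm, hαmem, fun i j => ?_⟩
    rw [← intervalIntegral.integral_add_adjacent_intervals (hint α hαm hαmem i j 0 a)
      (hint α hαm hαmem i j a 1)]
    have e1 : ∫ t in (0 : ℝ)..a, α t i j = a * B₁ i j := by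
      have : ∫ t in (0 : ℝ)..a, α t i j = ∫ t in (0 : ℝ)..a, α₁ (t / a) i j := by
        refine intervalIntegral.integral_congr_ae (Eventually.of_forall fun t ht => ?_)
        rw [uIoc_of_le ha] at ht
        simp [hα, ht.2]
      rw [this, intervalIntegral.integral_comp_div (fun t => α₁ t i j) ha'.ne', zero_div,
        div_self ha'.ne', hi₁, smul_eq_mul]
    have e2 : ∫ t in a..1, α t i j = b * B₂ i j := by
      have : ∫ t in a..1, α t i j = ∫ t in a..1, α₂ (t / b - a / b) i j := by
        refine intervalIntegral.integral_congr_ae (Eventually.of_forall fun t ht => ?_)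
        rw [uIoc_of_le (by linarith)] at ht
        simp [hα, not_le.2 ht.1, sub_div]
      rw [this, intervalIntegral.integral_comp_div_sub (fun t => α₂ t i j) hb'.ne', sub_self,
        ← sub_div, show (1 - a) / b = 1 by rw [div_eq_one_iff_eq hb'.ne']; linarith,
        hi₂, smul_eq_mul]
    rw [e1, e2]
    simp
  refine convexHull_min ?_ hconv hB
  intro A hA
  exact ⟨fun _ => A, fun _ _ => measurable_const, fun _ => hA, fun i j => by simp⟩

/-- The linear functional `v ↦ w ⬝ v` in the complex coordinate. -/
noncomputable def dotC (w : Vec2) : ℂ →L[ℝ] ℝ := w 0 • Complex.reCLM + w 1 • Complex.imCLM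

theorem dotC_apply (w : Vec2) (z : ℂ) : dotC w z = w 0 * z.re + w 1 * z.im := by
  simp [dotC]

theorem dotC_opC (w : Vec2) (A : Mat2) (z : ℂ) : dotC w (opC A z) =
    w 0 * z.re * A 0 0 + w 0 * z.im * A 0 1 + w 1 * z.re * A 1 0 + w 1 * z.im * A 1 1 := by
  simp [dotC_apply, opC, holPart, antiPart]; ring

/-- Over a window where the law has mean `B`, freezing `z` at the initial time contributes exactly
`h` times the functional of `B z(a)`, that is `c h` times its value. Since `z` moves by `O(h)`,
freezing costs only `O(h²)`. -/
theorem PlaneTraj.dotC_step {𝒜 : Set Mat2} {A : ℝ → Mat2} {z : ℝ → ℂ} {M : ℝ}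
    (hz : PlaneTraj 𝒜 A z) (hM : ∀ A ∈ 𝒜, ∀ z, ‖opC A z‖ ≤ M * ‖z‖) (hM0 : 0 < M)
    {B : Mat2} {w : Vec2} {c : ℝ} (hw : ∀ u, dotC w (opC B u) = c * dotC w u) {a h C : ℝ}
    (ha : 0 ≤ a) (hh : 0 ≤ h) (hC : ∀ s ∈ Icc a (a + h), ‖z s‖ ≤ C)
    (hB : ∀ i j, ∫ s in a..(a + h), A s i j = h * B i j) :
    (1 + c * h) * dotC w (z a) - ‖dotC w‖ * M ^ 2 * C * h ^ 2 ≤ dotC w (z (a + h)) := by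
  have hah : a ≤ a + h := by linarith
  have hah0 : 0 ≤ a + h := by linarith
  have hC0 : 0 ≤ C := (norm_nonneg _).trans (hC a ⟨le_rfl, hah⟩)
  have hi1 := hz.intervalIntegrable hM hM0 (y := fun _ => z a) continuousOn_const ha hah0
  have hi2 := hz.intervalIntegrable hM hM0 (y := fun s => z s - z a)
    (hz.continuousOn.sub continuousOn_const) ha hah0
  have hent : ∀ i j, IntervalIntegrable (fun s => A s i j) volume a (a + h) := by
    intro i j
    have hc : ∀ s ∈ uIoc a (a + h), ‖A s i j‖ ≤ M := by
      intro s hs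
      rw [uIoc_of_le hah] at hs
      have hmem := hz.law_mem s (ha.trans hs.1.le)
      have h1 := hM _ hmem 1
      have h2 := hM _ hmem Complex.I
      rw [norm_one, mul_one] at h1
      rw [Complex.norm_I, mul_one] at h2
      rw [Real.norm_eq_abs]
      have e00 : (opC (A s) 1).re = A s 0 0 := by simp [opC, holPart, antiPart]; ring
      have e10 : (opC (A s) 1).im = A s 1 0 := by simp [opC, holPart, antiPart]; ring
      have e01 : (opC (A s) Complex.I).re = A s 0 1 := by simp [opC, holPart, antiPart]; ring
      have e11 : (opC (A s) Complex.I).im = A s 1 1 := by simp [opC, holPart, antiPart]; ring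
      fin_cases i <;> fin_cases j
      · exact e00 ▸ (Complex.abs_re_le_norm _).trans h1
      · exact e01 ▸ (Complex.abs_re_le_norm _).trans h2
      · exact e10 ▸ (Complex.abs_im_le_norm _).trans h1
      · exact e11 ▸ (Complex.abs_im_le_norm _).trans h2
    exact (intervalIntegrable_const (c := M)).mono_fun
      (hz.measurable_law i j).aestronglyMeasurable
      ((ae_restrict_mem measurableSet_uIoc).mono fun s hs => (hc s hs).trans (le_abs_self M))
  have e : z (a + h) - z a = (∫ s in a..(a + h), opC (A s) (z a))
      + ∫ s in a..(a + h), opC (A s) (z s - z a) := by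
    rw [hz.sub_eq_integral hM hM0 ha hah0, ← intervalIntegral.integral_add hi1 hi2]
    simp only [← opC_add, add_sub_cancel]
  have e1 : dotC w (∫ s in a..(a + h), opC (A s) (z a)) = c * h * dotC w (z a) := by
    rw [← ContinuousLinearMap.intervalIntegral_comp_comm _ hi1]
    simp only [dotC_opC]
    have i00 := (hent 0 0).const_mul (w 0 * (z a).re)
    have i01 := (hent 0 1).const_mul (w 0 * (z a).im)
    have i10 := (hent 1 0).const_mul (w 1 * (z a).re)
    have i11 := (hent 1 1).const_mul (w 1 * (z a).im)
    rw [intervalIntegral.integral_add ((i00.add i01).add i10) i11,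
      intervalIntegral.integral_add (i00.add i01) i10, intervalIntegral.integral_add i00 i01]
    simp only [intervalIntegral.integral_const_mul, hB]
    have := hw (z a)
    rw [dotC_opC] at this
    linear_combination h * this
  have e2 : |dotC w (∫ s in a..(a + h), opC (A s) (z s - z a))| ≤
      ‖dotC w‖ * M ^ 2 * C * h ^ 2 := by
    refine ((dotC w).le_opNorm _).trans ?_
    have : ‖∫ s in a..(a + h), opC (A s) (z s - z a)‖ ≤ M * (M * C * h) * |a + h - a| := by
      refine intervalIntegral.norm_integral_le_of_norm_le_const fun s hs => ?_
      rw [uIoc_of_le hah] at hs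
      refine (hM _ (hz.law_mem s (ha.trans hs.1.le)) _).trans
        (mul_le_mul_of_nonneg_left ?_ hM0.le)
      refine (hz.norm_sub_le hM hM0 ha hs.1.le fun r hr => hC r ⟨hr.1, hr.2.trans hs.2⟩).trans ?_
      exact mul_le_mul_of_nonneg_left (by linarith [hs.2]) (by positivity)
    rw [add_sub_cancel_left, abs_of_nonneg hh] at this
    calc _ ≤ ‖dotC w‖ * (M * (M * C * h) * h) :=
          mul_le_mul_of_nonneg_left this (norm_nonneg _)
      _ = _ := by ring
  have e3 : dotC w (z (a + h)) = dotC w (z a) + c * h * dotC w (z a)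
      + dotC w (∫ s in a..(a + h), opC (A s) (z s - z a)) := by
    rw [← e1, add_assoc, ← map_add, ← e, ← map_add, add_sub_cancel]
  rw [e3]
  have := (abs_le.1 e2).1
  linarith

/-- `B - c` is singular on the left as well. A left eigenvector is preferred because its functional
obeys a scalar equation under `B`, whatever the other coordinate does. -/
theorem HullHasNonnegEigenvalue.exists_left {𝒜 : Set Mat2} (h : HullHasNonnegEigenvalue 𝒜) :
    ∃ B ∈ convexHull ℝ 𝒜, ∃ c : ℝ, 0 ≤ c ∧ ∃ w : Vec2, w ≠ 0 ∧
      ∀ u, dotC w (opC B u) = c * dotC w u := by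
  obtain ⟨B, hB, c, hc, hev⟩ := h
  obtain ⟨v, hv⟩ := hev.exists_hasEigenvector
  have hv1 : B *ᵥ v = c • v := by simpa using hv.apply_eq_smul
  have hdet : (B - c • (1 : Mat2)).det = 0 :=
    Matrix.exists_mulVec_eq_zero_iff.1 ⟨v, hv.2, by
      rw [Matrix.sub_mulVec, hv1, Matrix.smul_mulVec, Matrix.one_mulVec, sub_self]⟩
  obtain ⟨w, hw, hw'⟩ := Matrix.exists_vecMul_eq_zero_iff.2 hdet
  refine ⟨B, hB, c, hc, w, hw, fun u => ?_⟩
  have h0 := congrFun hw' 0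
  have h1 := congrFun hw' 1
  simp [Matrix.vecMul, dotProduct, Fin.sum_univ_two] at h0 h1
  rw [dotC_opC, dotC_apply]
  linear_combination u.re * h0 + u.im * h1

/-- A stable system has no matrix with a nonnegative eigenvalue in its convex hull. -/
theorem StableSystem.not_hullHasNonnegEigenvalue {𝒜 : Set Mat2} (hcompact : IsCompact 𝒜)
    (hst : StableSystem 𝒜) : ¬ HullHasNonnegEigenvalue 𝒜 := by
  intro hH
  obtain ⟨M, hM0, hM, -⟩ := exists_opC_bound hcompact
  obtain ⟨B, hB, c, hc, w, hw, hwB⟩ := hH.exists_left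
  obtain ⟨α, hαm, hα, hαi⟩ := exists_law_of_mem_convexHull hcompact hB
  obtain ⟨z₀, hz₀⟩ : ∃ z₀, dotC w z₀ = 1 := by
    have hn : w 0 ^ 2 + w 1 ^ 2 ≠ 0 := by
      intro h
      apply hw
      ext i
      fin_cases i
      · simpa using (show w 0 = 0 by nlinarith [sq_nonneg (w 0), sq_nonneg (w 1)])
      · simpa using (show w 1 = 0 by nlinarith [sq_nonneg (w 0), sq_nonneg (w 1)])
    refine ⟨⟨w 0 / (w 0 ^ 2 + w 1 ^ 2), w 1 / (w 0 ^ 2 + w 1 ^ 2)⟩, ?_⟩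
    rw [dotC_apply]
    field_simp
  -- `C n` bounds the trajectory on `[n, n + 1]`, and `E n * h ^ 2` is then the loss in one window
  -- of length `h`. With `N n` windows the loss over the unit interval is `E n / N n ≤ 2^{-(n+2)}`,
  -- a summable amount.
  set C : ℕ → ℝ := fun n => 2 * ‖z₀‖ * Real.exp (2 * M * (n + 1)) with hC
  set E : ℕ → ℝ := fun n => ‖dotC w‖ * M ^ 2 * C n with hE
  set N : ℕ → ℕ := fun n => ⌈E n * 2 ^ (n + 2)⌉₊ + 1 with hN
  have hNpos : ∀ n, (0 : ℝ) < N n := fun n => by rw [hN]; positivity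
  have hNE : ∀ n, E n / N n ≤ (1 / 2) ^ (n + 2) := by
    intro n
    rw [div_le_iff₀ (hNpos n), _root_.one_div_pow, div_mul_eq_mul_div, one_mul,
      le_div_iff₀ (by positivity)]
    refine (Nat.le_ceil _).trans ?_
    rw [hN]; push_cast; linarith
  have hEnn : ∀ n, 0 ≤ E n := fun n => by simp only [hE, hC]; positivity
  -- On `(n, n + 1]` one has `⌈t⌉₊ - 1 = n`, and the law runs through `α` there `N n` times; `y -
  -- ⌈y⌉ + 1` is the fractional part taken in `(0, 1]`.
  set A : ℝ → Mat2 := fun t => α ((N (⌈t⌉₊ - 1) : ℝ) * t - ⌈(N (⌈t⌉₊ - 1) : ℝ) * t⌉ + 1) with hA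
  have hAm : ∀ i j, Measurable fun t => A t i j := by
    intro i j
    have h1 : Measurable fun t : ℝ => (N (⌈t⌉₊ - 1) : ℝ) :=
      (measurable_of_countable fun n : ℕ => (N (n - 1) : ℝ)).comp Nat.measurable_ceil
    have h2 : Measurable fun t : ℝ => (⌈(N (⌈t⌉₊ - 1) : ℝ) * t⌉ : ℝ) :=
      (measurable_of_countable fun n : ℤ => (n : ℝ)).comp
        (Int.measurable_ceil.comp (h1.mul measurable_id))
    exact (hαm i j).comp (((h1.mul measurable_id).sub h2).add measurable_const)
  obtain ⟨z, hz, hz0, hzb⟩ := exists_planeTraj hM hM0 hAm (fun t => hα _) z₀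
  have hblock : ∀ n k : ℕ, k < N n → ∀ i j,
      ∫ s in (n + k / N n : ℝ)..(n + k / N n + 1 / N n : ℝ), A s i j = 1 / N n * B i j := by
    intro n k hk i j
    have hNn := hNpos n
    have hk' : (k : ℝ) + 1 ≤ N n := by exact_mod_cast hk
    have e1 : ∫ s in (n + k / N n : ℝ)..(n + k / N n + 1 / N n : ℝ), A s i j =
        ∫ s in (n + k / N n : ℝ)..(n + k / N n + 1 / N n : ℝ),
          α ((N n : ℝ) * s - (n * N n + k)) i j := by
      refine intervalIntegral.integral_congr_ae (Eventually.of_forall fun s hs => ?_)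
      rw [uIoc_of_le (by linarith [one_div_pos.2 hNn])] at hs
      have hs1 : (n : ℝ) * N n + k < N n * s := by
        have := mul_lt_mul_of_pos_right hs.1 hNn
        rw [add_mul, div_mul_cancel₀ _ hNn.ne'] at this
        linarith
      have hs2 : N n * s ≤ (n : ℝ) * N n + k + 1 := by
        have := mul_le_mul_of_nonneg_right hs.2 hNn.le
        rw [add_mul, add_mul, div_mul_cancel₀ _ hNn.ne', div_mul_cancel₀ _ hNn.ne'] at this
        linarith
      have hn1 : (n : ℝ) < s := by
        have : (n : ℝ) * N n < s * N n := by
          have : (0 : ℝ) ≤ k := Nat.cast_nonneg k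
          linarith
        exact lt_of_mul_lt_mul_right this hNn.le
      have hn2 : s ≤ n + 1 := by
        have : s * N n ≤ (n + 1) * (N n : ℝ) := by linarith
        exact le_of_mul_le_mul_right this hNn
      have hceil : ⌈s⌉₊ = n + 1 := by
        rw [Nat.ceil_eq_iff (by simp)]
        simp [hn1, hn2]
      have hceil2 : ⌈(N n : ℝ) * s⌉ = n * N n + k + 1 := by
        rw [Int.ceil_eq_iff]
        push_cast
        constructor <;> linarith
      simp only [hA, hceil, Nat.add_sub_cancel, hceil2]
      have harg : (N n : ℝ) * s - ((n * N n + k + 1 : ℤ) : ℝ) + 1 = N n * s - (n * N n + k) := by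
        push_cast; ring
      rw [harg]
    rw [e1, intervalIntegral.integral_comp_mul_sub (fun s => α s i j) hNn.ne']
    have e2 : (N n : ℝ) * (n + k / N n) - (n * N n + k) = 0 := by field_simp; ring
    have e3 : (N n : ℝ) * (n + k / N n + 1 / N n) - (n * N n + k) = 1 := by field_simp; ring
    rw [e2, e3, hαi, smul_eq_mul, one_div]
  have hunit : ∀ n : ℕ, 1 / 2 ≤ dotC w (z n) → ∀ k : ℕ, k ≤ N n →
      dotC w (z n) - k * (E n / N n ^ 2) ≤ dotC w (z (n + k / N n)) := by
    intro n hn k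
    induction k with
    | zero => intro _; simp
    | succ k ih =>
      intro hk
      have hNn := hNpos n
      have hk' : (k : ℝ) + 1 ≤ N n := by exact_mod_cast hk
      have ih' := ih (by omega)
      have hpos : 0 ≤ dotC w (z (n + k / N n)) := by
        have h1 : (k : ℝ) * (E n / N n ^ 2) ≤ E n / N n := by
          rw [show E n / (N n : ℝ) = N n * (E n / N n ^ 2) by field_simp]
          exact mul_le_mul_of_nonneg_right (by linarith) (div_nonneg (hEnn n) (by positivity))
        have h2 : ((1 : ℝ) / 2) ^ (n + 2) ≤ (1 / 2) ^ 1 :=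
          pow_le_pow_of_le_one (by norm_num) (by norm_num) (by omega)
        have := hNE n
        norm_num at h2 this
        linarith
      have hstep := hz.dotC_step hM hM0 hwB (a := n + k / N n) (h := 1 / N n) (C := C n)
        (by positivity) (by positivity) (fun s hs => ?_) (hblock n k (by omega))
      · have : (n + k / N n + 1 / N n : ℝ) = n + (k + 1 : ℕ) / N n := by push_cast; ring
        rw [← this]
        refine le_trans ?_ hstep
        -- This is where `c ≥ 0` enters: while the functional is nonnegative, the growth term can be
        -- dropped.
        have h3 : 0 ≤ c * (1 / N n) * dotC w (z (n + k / N n)) := by positivity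
        have h4 : ‖dotC w‖ * M ^ 2 * C n * (1 / (N n : ℝ)) ^ 2 = E n / N n ^ 2 := by
          rw [hE]; field_simp
        rw [h4]
        push_cast
        linarith
      · have hs0 : (0 : ℝ) ≤ s := le_trans (by positivity) hs.1
        refine (hzb s hs0).trans ?_
        simp only [hC]
        gcongr
        refine hs.2.trans ?_
        have : (k + 1 : ℝ) / N n ≤ 1 := (div_le_one hNn).2 hk'
        rw [add_div] at this
        linarith
  -- The bound starts at `1`, the initial value of the functional, and each unit interval lowers it
  -- by the permitted `2^{-(n+2)}`.
  have hall : ∀ n : ℕ, 1 / 2 + (1 / 2 : ℝ) ^ (n + 1) ≤ dotC w (z n) := by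
    intro n
    induction n with
    | zero => simp [hz0, hz₀]; norm_num
    | succ n ih =>
      have hNn := hNpos n
      have hp : (0 : ℝ) < (1 / 2) ^ (n + 1) := by positivity
      have := hunit n (by linarith) (N n) le_rfl
      rw [div_self hNn.ne', show (N n : ℝ) * (E n / N n ^ 2) = E n / N n by field_simp] at this
      have h2 := hNE n
      have h3 : (1 / 2 : ℝ) ^ (n + 1) = 2 * (1 / 2) ^ (n + 2) := by rw [pow_succ _ (n + 1)]; ring
      push_cast
      linarith
  have hx : IsTrajectory 𝒜 A (fun t => toCL.symm (z t)) := by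
    rw [isTrajectory_iff]
    simpa only [toC_symm_apply] using hz
  have hlim := hst _ _ hx
  have hlim2 : Tendsto (fun n : ℕ => dotC w (z n)) atTop (𝓝 0) := by
    have h1 := ((dotC w).continuous.comp toCL.continuous).tendsto 0
    simp only [Function.comp_apply, map_zero] at h1
    refine ((h1.comp hlim).comp tendsto_natCast_atTop_atTop).congr fun n => ?_
    simp
  have := ge_of_tendsto' hlim2 (b := 1 / 2) fun n => by
    have : (0 : ℝ) < (1 / 2) ^ (n + 1) := by positivity
    linarith [hall n]
  norm_num at this

/-! ### Round trajectories: growth factor and change of starting point -/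

theorem lipschitzOnWith_integral {p : ℝ → ℂ} {t M : ℝ} (ht : 0 ≤ t)
    (hp : IntervalIntegrable p volume 0 t) (hb : ∀ s ∈ Icc 0 t, ‖p s‖ ≤ M) :
    LipschitzOnWith M.toNNReal (fun s => ∫ r in (0 : ℝ)..s, p r) (uIcc 0 t) := by
  refine LipschitzOnWith.of_dist_le_mul fun a ha b hb' => ?_
  rw [uIcc_of_le ht] at ha hb'
  have hM : 0 ≤ M := (norm_nonneg _).trans (hb a ha)
  have hsub : ∀ s ∈ Icc 0 t, IntervalIntegrable p volume 0 s := fun s hs =>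
    hp.mono_set (by rw [uIcc_of_le ht, uIcc_of_le hs.1]; exact Icc_subset_Icc_right hs.2)
  rw [dist_comm, dist_eq_norm, intervalIntegral.integral_interval_sub_left (hsub b hb') (hsub a ha),
    Real.coe_toNNReal _ hM, dist_comm, Real.dist_eq]
  refine intervalIntegral.norm_integral_le_of_norm_le_const fun s hs => hb s ?_
  have := uIoc_subset_uIcc hs
  exact ⟨(le_inf ha.1 hb'.1).trans this.1, this.2.trans (sup_le ha.2 hb'.2)⟩

/-- A scalar linear equation with bounded measurable coefficient is solved by the exponential of
the integral. -/
theorem eq_mul_exp_integral {z p : ℝ → ℂ} {t M : ℝ} (ht : 0 ≤ t)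
    (hp : IntervalIntegrable p volume 0 t) (hb : ∀ s ∈ Icc 0 t, ‖p s‖ ≤ M)
    (hzc : ContinuousOn z (Icc 0 t))
    (hz : ∀ s ∈ Icc 0 t, z s = z 0 + ∫ r in (0 : ℝ)..s, p r * z r) :
    z t = z 0 * Complex.exp (∫ s in (0 : ℝ)..t, p s) := by
  have hM : 0 ≤ M := (norm_nonneg _).trans (hb 0 ⟨le_rfl, ht⟩)
  obtain ⟨C, hC⟩ := isCompact_Icc.exists_bound_of_continuousOn hzc
  have hpz : IntervalIntegrable (fun r => p r * z r) volume 0 t :=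
    hp.mul_continuousOn (by rwa [uIcc_of_le ht])
  have hbz : ∀ s ∈ Icc 0 t, ‖p s * z s‖ ≤ M * C := fun s hs => by
    rw [norm_mul]
    exact mul_le_mul (hb s hs) (hC s hs) (norm_nonneg _) hM
  set P : ℝ → ℂ := fun s => ∫ r in (0 : ℝ)..s, p r with hP
  set Z : ℝ → ℂ := fun s => ∫ r in (0 : ℝ)..s, p r * z r with hZ
  have hPL := lipschitzOnWith_integral ht hp hb
  have hZac : AbsolutelyContinuousOnInterval (fun s => z 0 + Z s) 0 t := by
    refine LipschitzOnWith.absolutelyContinuousOnInterval (K := (M * C).toNNReal) ?_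
    refine LipschitzOnWith.of_dist_le_mul fun a ha b hb' => ?_
    rw [dist_add_left]
    exact (lipschitzOnWith_integral ht hpz hbz).dist_le_mul a ha b hb'
  have hEac : AbsolutelyContinuousOnInterval (fun s => Complex.exp (-P s)) 0 t := by
    have hexp : ContDiffOn ℝ 1 (fun u : ℂ => Complex.exp (-u)) (Metric.closedBall 0 (M * t)) := by
      apply ContDiff.contDiffOn; fun_prop
    obtain ⟨K, hK⟩ := hexp.exists_lipschitzOnWith (by decide) (convex_closedBall _ _)
      (isCompact_closedBall _ _)
    refine (hK.comp hPL fun s hs => ?_).absolutelyContinuousOnInterval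
    rw [uIcc_of_le ht] at hs
    rw [mem_closedBall_zero_iff]
    have := intervalIntegral.norm_integral_le_of_norm_le_const (a := 0) (b := s) (f := p) (C := M)
      (fun r hr => by
        rw [uIoc_of_le hs.1] at hr
        exact hb r ⟨hr.1.le, hr.2.trans hs.2⟩)
    refine this.trans ?_
    rw [sub_zero, abs_of_nonneg hs.1]
    exact mul_le_mul_of_nonneg_left hs.2 hM
  -- The product `exp(-P) z` is absolutely continuous with derivative zero almost everywhere, hence
  -- constant; continuity alone would not suffice.
  have hac := hEac.smul hZac
  obtain ⟨k, hk⟩ := hac.const_of_ae_hasDerivAt_zero (by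
    filter_upwards [hp.ae_hasDerivAt_integral, hpz.ae_hasDerivAt_integral] with s h1 h2 hs
    have d1 := (h1 hs 0 left_mem_uIcc)
    have d2 := (h2 hs 0 left_mem_uIcc)
    have d := (d1.neg.cexp).smul (d2.const_add (z 0))
    refine d.congr_deriv ?_
    rw [uIcc_of_le ht] at hs
    rw [← hz s hs]
    simp only [smul_eq_mul]
    ring)
  have h0 := hk 0 left_mem_uIcc
  have h1 := hk t right_mem_uIcc
  have hzt := hz t ⟨ht, le_rfl⟩
  simp only [Pi.smul_apply', smul_eq_mul, hP, hZ, intervalIntegral.integral_same, neg_zero,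
    Complex.exp_zero, one_mul, add_zero] at h0 h1
  rw [← hzt, ← h0] at h1
  rw [← h1, mul_right_comm, ← Complex.exp_add, neg_add_cancel, Complex.exp_zero, one_mul]

theorem PlaneTraj.congr_law {𝒜 : Set Mat2} {A A' : ℝ → Mat2} {z : ℝ → ℂ}
    (hz : PlaneTraj 𝒜 A z) (hA' : ∀ i j, Measurable fun t => A' t i j)
    (h : ∀ t, 0 ≤ t → A' t = A t) : PlaneTraj 𝒜 A' z := by
  refine ⟨hA', fun t ht => h t ht ▸ hz.law_mem t ht, hz.continuousOn, fun t ht => ?_⟩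
  rw [hz.solves t ht]
  congr 1
  refine intervalIntegral.integral_congr fun s hs => ?_
  rw [uIcc_of_le ht] at hs
  simp only [h s hs.1]

/-- A round trajectory reproduces itself, up to the factor, after each half-turn. -/
theorem IsRound.add_period {𝒜 : Set Mat2} (hcompact : IsCompact 𝒜) {A : ℝ → Mat2} {x : ℝ → Vec2}
    {T c : ℝ} (hx : IsTrajectory 𝒜 A x) (hr : IsRound A x T c) {t : ℝ} (ht : 0 ≤ t) :
    x (T + t) = -(c • x t) := by
  obtain ⟨M, hM0, hM, -⟩ := exists_opC_bound hcompact
  have hz := isTrajectory_iff.1 hx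
  -- By periodicity of the law, `x (T + ·)` and `-c x` solve the same linear equation with the same
  -- initial value.
  have h1 := (hz.shift hM hM0 hr.time_pos.le).congr_law hz.measurable_law fun t ht => by
    rw [add_comm, hr.periodic_law t ht]
  have h2 := hz.real_mul (-c)
  have := h1.eqOn_of_initial_eq h2 hM hM0 (by
    rw [add_zero, hr.half_turn, toC_neg, toC_smul]; push_cast; ring) ht
  apply toC_injective
  rw [this, toC_neg, toC_smul]; push_cast; ring

/-- Iterating half-turns gives `‖x (n T)‖ = c ^ n ‖x 0‖`, which does not tend to zero when `c ≥ 1`.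
-/
theorem IsRound.factor_lt_one {𝒜 : Set Mat2} (hcompact : IsCompact 𝒜) (hst : StableSystem 𝒜)
    {A : ℝ → Mat2} {x : ℝ → Vec2}
    {T c : ℝ} (hx : IsTrajectory 𝒜 A x) (hr : IsRound A x T c) : c < 1 := by
  by_contra hc
  push Not at hc
  have hn : ∀ n : ℕ, ‖x (n * T)‖ = c ^ n * ‖x 0‖ := by
    intro n
    induction n with
    | zero => simp
    | succ n ih =>
      have e : ((n + 1 : ℕ) : ℝ) * T = T + n * T := by push_cast; ring
      rw [e, hr.add_period hcompact hx (mul_nonneg n.cast_nonneg hr.time_pos.le), norm_neg,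
        norm_smul, ih, Real.norm_of_nonneg hr.factor_pos.le, pow_succ]
      ring
  have hlim : Tendsto (fun n : ℕ => ‖x (n * T)‖) atTop (𝓝 0) := by
    have h1 : Tendsto (fun n : ℕ => (n : ℝ) * T) atTop atTop :=
      tendsto_natCast_atTop_atTop.atTop_mul_const hr.time_pos
    simpa using ((hst A x hx).comp h1).norm
  have hge := ge_of_tendsto' hlim (b := ‖x 0‖) fun n => by
    rw [hn]
    exact le_mul_of_one_le_left (norm_nonneg _) (one_le_pow₀ hc)
  exact hr.start_ne_zero (norm_le_zero_iff.1 hge)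

theorem im_pos_of_arg_mem {u : ℂ} (h : u.arg ∈ Ioo 0 Real.pi) : 0 < u.im := by
  have hs := Real.sin_pos_of_pos_of_lt_pi h.1 h.2
  rw [Complex.sin_arg] at hs
  by_contra hn
  exact absurd hs (not_lt.2 (div_nonpos_of_nonpos_of_nonneg (not_lt.1 hn) (norm_nonneg _)))

theorem IsLeadingLeft.im_pos {𝒜 : Set Mat2} {x : Vec2} {A : Mat2} (h : IsLeadingLeft 𝒜 x A) :
    toC x ≠ 0 ∧ 0 < (opC A (toC x) / toC x).im := by
  have h1 := h.angle_mem
  rw [orientedAngle, toC_mulVec] at h1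
  have h2 := im_pos_of_arg_mem h1
  refine ⟨fun h0 => ?_, h2⟩
  rw [h0] at h2
  simp at h2

theorem orientedAngle_smul {d : ℝ} (hd : d ≠ 0) (x : Vec2) (B : Mat2) :
    orientedAngle (d • x) (B *ᵥ (d • x)) = orientedAngle x (B *ᵥ x) := by
  rw [orientedAngle, orientedAngle, Matrix.mulVec_smul, toC_smul, toC_smul,
    mul_div_mul_left _ _ (by exact_mod_cast hd)]

theorem euclLength_smul (d : ℝ) (x : Vec2) : euclLength (d • x) = |d| * euclLength x := by
  rw [euclLength, euclLength, toC_smul, norm_mul, Complex.norm_real, Real.norm_eq_abs]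

theorem Feasible.smul {𝒜 : Set Mat2} {x : Vec2} (h : Feasible 𝒜 x) {d : ℝ} (hd : d ≠ 0) :
    Feasible 𝒜 (d • x) := by
  rintro ⟨A, hA, c, hc, he⟩
  refine h ⟨A, hA, c, hc, ?_⟩
  rw [Matrix.mulVec_smul, smul_comm] at he
  exact smul_right_injective _ hd he

theorem IsLeadingLeft.smul {𝒜 : Set Mat2} {x : Vec2} {A : Mat2} (h : IsLeadingLeft 𝒜 x A)
    {d : ℝ} (hd : d ≠ 0) : IsLeadingLeft 𝒜 (d • x) A := by
  refine ⟨h.feasible.smul hd, h.mem, ?_, fun B hB hB' => ?_, fun B hB hB' => ?_⟩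
  · rw [orientedAngle_smul hd]; exact h.angle_mem
  · rw [orientedAngle_smul hd] at hB' ⊢
    rw [orientedAngle_smul hd]
    exact h.angle_le B hB hB'
  · rw [orientedAngle_smul hd, orientedAngle_smul hd] at hB'
    rw [Matrix.mulVec_smul, Matrix.mulVec_smul, euclLength_smul, euclLength_smul]
    exact mul_le_mul_of_nonneg_left (h.length_le B hB hB') (abs_nonneg d)

/-- A round leading left trajectory can be restarted at any nonzero point. -/
theorem IsRoundLeft.exists_start {𝒜 : Set Mat2} (hcompact : IsCompact 𝒜) {A : ℝ → Mat2}
    {x : ℝ → Vec2} {T c : ℝ} (h : IsRoundLeft 𝒜 A x T c) {y₀ : Vec2} (hy₀ : y₀ ≠ 0) :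
    ∃ A' x', x' 0 = y₀ ∧ IsRoundLeft 𝒜 A' x' T c := by
  obtain ⟨M, hM0, hM, -⟩ := exists_opC_bound hcompact
  have hz := isTrajectory_iff.1 h.trajectory
  have hT := h.round.time_pos
  set z : ℝ → ℂ := fun t => toC (x t) with hzdef
  set p : ℝ → ℂ := fun t => opC (A t) (z t) / z t with hp
  have hz0 : ∀ t, 0 ≤ t → z t ≠ 0 := fun t ht => (h.leading t ht).im_pos.1
  have him : ∀ t, 0 ≤ t → 0 < (p t).im := fun t ht => (h.leading t ht).im_pos.2
  have hpb : ∀ t, 0 ≤ t → ‖p t‖ ≤ M := fun t ht => by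
    rw [hp, norm_div, div_le_iff₀ (norm_pos_iff.2 (hz0 t ht))]
    exact hM _ (hz.law_mem t ht) _
  have hpint : ∀ a b, 0 ≤ a → 0 ≤ b → IntervalIntegrable p volume a b := by
    intro a b ha hb
    have h1 := hz.intervalIntegrable hM hM0 hz.continuousOn ha hb
    have : ContinuousOn (fun t => (z t)⁻¹) (uIcc a b) :=
      (hz.continuousOn.mono fun s hs => (le_inf ha hb).trans hs.1).inv₀
        fun s hs => hz0 s ((le_inf ha hb).trans hs.1)
    simpa only [hp, div_eq_mul_inv] using h1.mul_continuousOn this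
  -- `P` is a continuous logarithm of `z / z 0`. Its imaginary part is the angle swept, strictly
  -- increasing because a leading left matrix turns left.
  set P : ℝ → ℂ := fun t => ∫ s in (0 : ℝ)..t, p s with hP
  have hlift : ∀ t, 0 ≤ t → z t = z 0 * Complex.exp (P t) := by
    intro t ht
    refine eq_mul_exp_integral ht (hpint 0 t le_rfl ht) (fun s hs => hpb s hs.1)
      (hz.continuousOn.mono fun s hs => hs.1) fun s hs => ?_
    rw [hz.solves s hs.1]
    congr 1
    refine intervalIntegral.integral_congr fun r hr => ?_
    rw [uIcc_of_le hs.1] at hr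
    simp only [hp]
    rw [div_mul_cancel₀ _ (hz0 r hr.1)]
  have hPsub : ∀ a b, 0 ≤ a → 0 ≤ b → P b - P a = ∫ s in a..b, p s := fun a b ha hb =>
    intervalIntegral.integral_interval_sub_left (hpint 0 b le_rfl hb) (hpint 0 a le_rfl ha)
  have himlin : ∀ a b, 0 ≤ a → 0 ≤ b → (∫ s in a..b, p s).im = ∫ s in a..b, (p s).im :=
    fun a b ha hb =>
      (ContinuousLinearMap.intervalIntegral_comp_comm Complex.imCLM (hpint a b ha hb)).symm
  have hmono : ∀ a b, 0 ≤ a → a < b → (P a).im < (P b).im := by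
    intro a b ha hab
    rw [← sub_pos, ← Complex.sub_im, hPsub a b ha (ha.trans hab.le), himlin a b ha (ha.trans hab.le)]
    refine intervalIntegral.intervalIntegral_pos_of_pos_on ?_ (fun s hs => him s (ha.trans hs.1.le))
      hab
    have := hpint a b ha (ha.trans hab.le)
    exact ⟨this.1.im, this.2.im⟩
  have hPcont : ContinuousOn (fun t => (P t).im) (Icc 0 T) := by
    have := intervalIntegral.continuousOn_primitive_interval' (hpint 0 T le_rfl hT.le)
      (left_mem_uIcc)
    rw [uIcc_of_le hT.le] at this
    exact Complex.continuous_im.comp_continuousOn this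
  have hP0 : P 0 = 0 := by simp [hP]
  have hmulre : ∀ t, 0 ≤ t → ∀ d : ℝ, x t = d • x 0 ↔ Complex.exp (P t) = d := by
    intro t ht d
    rw [← toC_injective.eq_iff, toC_smul]
    change z t = d * z 0 ↔ _
    rw [hlift t ht, mul_comm (d : ℂ)]
    exact mul_right_inj' (hz0 0 le_rfl)
  -- The half-turn condition makes the swept angle an odd multiple of `π`; a larger one than `π`
  -- would have passed `π` before time `T`, against `first_time`.
  have hPT : (P T).im = Real.pi := by
    have h1 := (hmulre T hT.le (-c)).1 (by rw [h.round.half_turn, neg_smul])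
    have hsin : Real.sin (P T).im = 0 := by
      have := congrArg Complex.im h1
      rw [Complex.exp_im, Complex.ofReal_im] at this
      exact (mul_eq_zero.1 this).resolve_left (Real.exp_pos _).ne'
    have hcos : Real.cos (P T).im < 0 := by
      have := congrArg Complex.re h1
      rw [Complex.exp_re, Complex.ofReal_re] at this
      have h2 := h.round.factor_pos
      by_contra hn
      have := mul_nonneg (Real.exp_pos (P T).re).le (not_lt.1 hn)
      linarith
    have hpos : 0 < (P T).im := by
      have := hmono 0 T le_rfl hT
      rwa [hP0] at this
    rcases lt_trichotomy (P T).im Real.pi with hlt | heq | hgt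
    · exact absurd hsin (Real.sin_pos_of_pos_of_lt_pi hpos hlt).ne'
    · exact heq
    · exfalso
      obtain ⟨s, hs, hs'⟩ := intermediate_value_Ioo hT.le hPcont
        (show Real.pi ∈ Ioo (P 0).im (P T).im by
          rw [hP0]; exact ⟨Real.pi_pos, hgt⟩)
      refine h.round.first_time s hs.1 hs.2 ⟨Real.exp (P s).re, Real.exp_pos _, ?_⟩
      rw [← neg_smul]
      refine (hmulre s hs.1.le _).2 ?_
      apply Complex.ext
      · rw [Complex.exp_re]; simp only at hs'; rw [hs']; simp [Complex.exp_ofReal_re]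
      · rw [Complex.exp_im]; simp only at hs'; rw [hs', Complex.ofReal_im]; simp
  have hper : ∀ t, 0 ≤ t → p (T + t) = p t := by
    intro t ht
    have h1 : z (T + t) = ((-c : ℝ) : ℂ) * z t := by
      simp only [hzdef]
      rw [h.round.add_period hcompact h.trajectory ht, toC_neg, toC_smul]; push_cast; ring
    simp only [hp]
    rw [h1, opC_real_mul, add_comm T t, h.round.periodic_law t ht,
      mul_div_mul_left _ _ (by exact_mod_cast (neg_ne_zero.2 h.round.factor_pos.ne'))]
  have hPper : ∀ t, 0 ≤ t → P (T + t) = P T + P t := by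
    intro t ht
    have h1 := hPsub T (T + t) hT.le (by positivity)
    have h2 := intervalIntegral.integral_comp_add_left p (a := 0) (b := t) T
    rw [add_zero] at h2
    rw [← sub_eq_iff_eq_add', h1, ← h2]
    refine intervalIntegral.integral_congr fun s hs => ?_
    rw [uIcc_of_le ht] at hs
    exact hper s hs.1
  -- the starting time
  obtain ⟨a, ha, d, hd, had⟩ : ∃ a, 0 ≤ a ∧ ∃ d : ℝ, d ≠ 0 ∧ y₀ = d • x a := by
    have hy : toC y₀ / z 0 ≠ 0 := div_ne_zero (fun h0 => hy₀ (toC_eq_zero.1 h0)) (hz0 0 le_rfl)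
    -- Reduced modulo `π`, the direction of `y₀` is met during the first half-turn. The parity of
    -- `n` decides the sign of `d`, through `cos (n π)`.
    obtain ⟨n, hn, -⟩ := existsUnique_sub_zsmul_mem_Ico Real.pi_pos (toC y₀ / z 0).arg 0
    rw [zero_add] at hn
    obtain ⟨a, ha, hae⟩ := intermediate_value_Icc hT.le hPcont
      (show (toC y₀ / z 0).arg - n • Real.pi ∈ Icc (P 0).im (P T).im by
        rw [hP0, hPT]; exact ⟨hn.1, hn.2.le⟩)
    simp only at hae
    refine ⟨a, ha.1, ‖toC y₀ / z 0‖ * Real.cos (n * Real.pi) * Real.exp (-(P a).re), ?_, ?_⟩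
    · refine mul_ne_zero (mul_ne_zero (norm_ne_zero_iff.2 hy) ?_) (Real.exp_pos _).ne'
      rw [Real.cos_int_mul_pi]
      exact zpow_ne_zero _ (by norm_num)
    · apply toC_injective
      rw [toC_smul]
      change _ = _ * z a
      have e1 : toC y₀ = z 0 * (toC y₀ / z 0) := by
        rw [mul_div_cancel₀ _ (hz0 0 le_rfl)]
      have e2 : (toC y₀ / z 0) = ‖toC y₀ / z 0‖ *
          Complex.exp ((toC y₀ / z 0).arg * Complex.I) := (Complex.norm_mul_exp_arg_mul_I _).symm
      have e3 : (toC y₀ / z 0).arg = n * Real.pi + (P a).im := by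
        rw [hae, zsmul_eq_mul]; ring
      have e4 : Complex.exp ((n * Real.pi : ℝ) * Complex.I) = (Real.cos (n * Real.pi) : ℂ) := by
        rw [Complex.exp_mul_I, ← Complex.ofReal_cos, ← Complex.ofReal_sin, Real.sin_int_mul_pi]
        simp
      have e5 : Complex.exp (P a) = Real.exp (P a).re * Complex.exp ((P a).im * Complex.I) := by
        rw [Complex.ofReal_exp, ← Complex.exp_add, Complex.re_add_im]
      have e6 : (Real.exp (-(P a).re) : ℂ) * Real.exp (P a).re = 1 := by
        rw [← Complex.ofReal_mul, ← Real.exp_add]; simp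
      have e7 : Complex.exp ((toC y₀ / z 0).arg * Complex.I)
          = (Real.cos (n * Real.pi) : ℂ) * Complex.exp ((P a).im * Complex.I) := by
        rw [e3, ← e4, ← Complex.exp_add]
        congr 1
        push_cast
        ring
      refine e1.trans ?_
      rw [hlift a ha.1, e5]
      conv_lhs => rw [e2, e7]
      simp only [Complex.ofReal_mul]
      linear_combination (-(‖toC y₀ / z 0‖ : ℂ) * (Real.cos (n * Real.pi) : ℂ) * z 0 *
        Complex.exp ((P a).im * Complex.I)) * e6
  refine ⟨fun t => A (a + t), fun t => d • x (a + t), by simp [had], ⟨?_, fun t ht => ?_, ?_⟩⟩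
  · rw [isTrajectory_iff]
    have := (hz.shift hM hM0 ha).real_mul d
    simpa only [toC_smul] using this
  · exact (h.leading _ (add_nonneg ha ht)).smul hd
  · refine ⟨by simpa [← had] using hy₀, hT, h.round.factor_pos, ?_, ?_, ?_⟩
    · have := h.round.add_period hcompact h.trajectory ha
      rw [add_comm] at this
      simp only [add_zero, this]
      rw [smul_neg, smul_comm]
    · rintro s hs hsT ⟨e, he, hse⟩
      simp only [add_zero] at hse
      rw [smul_comm e d, ← smul_neg] at hse
      have hse' := smul_right_injective _ hd hse
      have h1 : z (a + s) = -(e * z a) := by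
        simp only [hzdef, hse', toC_neg, toC_smul]
      rw [hlift _ (add_nonneg ha hs.le), hlift a ha] at h1
      have h2 : Complex.exp (P (a + s) - P a) = -e := by
        rw [Complex.exp_sub, div_eq_iff (Complex.exp_ne_zero _)]
        apply mul_left_cancel₀ (hz0 0 le_rfl)
        rw [h1]; ring
      have h3 := congrArg Complex.im h2
      rw [Complex.exp_im, ← Complex.ofReal_neg, Complex.ofReal_im] at h3
      have h4 := (mul_eq_zero.1 h3).resolve_left (Real.exp_pos _).ne'
      -- Between times `a` and `a + s < a + T` the swept angle lies strictly between `0` and `π`, so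
      -- its sine cannot vanish.
      refine absurd h4 (Real.sin_pos_of_pos_of_lt_pi ?_ ?_).ne'
      · rw [Complex.sub_im, sub_pos]
        exact hmono a (a + s) ha (by linarith)
      · have h5 := hmono (a + s) (T + a) (by positivity) (by linarith)
        rw [hPper a ha, Complex.add_im, hPT] at h5
        rw [Complex.sub_im]
        linarith
    · intro t ht
      rw [← add_assoc]
      exact h.round.periodic_law _ (add_nonneg ha ht)

/-! ### Separation of variables for a measurable angular speed -/

/-- Change of the time variable with a speed that is measurable and bounded away from `0` and `∞`. -/
theorem exists_time_change {m : ℝ → ℝ} (hm : Measurable m) {c C : ℝ} (hc : 0 < c)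
    (hcm : ∀ θ, c ≤ m θ) (hmC : ∀ θ, m θ ≤ C) (θ₀ : ℝ) :
    ∃ Θ : ℝ → ℝ, Continuous Θ ∧ StrictMono Θ ∧ Θ 0 = θ₀ ∧
      (∀ θ, Θ (∫ φ in θ₀..θ, (m φ)⁻¹) = θ) ∧ (∀ t, ∫ φ in θ₀..(Θ t), (m φ)⁻¹ = t) ∧
      ∀ (F : ℝ → ℂ) (t : ℝ), 0 ≤ t →
        ∫ s in (0 : ℝ)..t, F (Θ s) = ∫ φ in θ₀..(Θ t), (((m φ)⁻¹ : ℝ) : ℂ) * F φ := by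
  have hmpos : ∀ θ, 0 < m θ := fun θ => hc.trans_le (hcm θ)
  have hCpos : 0 < C := (hmpos 0).trans_le (hmC 0)
  have hint : ∀ a b, IntervalIntegrable (fun φ => (m φ)⁻¹) volume a b := fun a b =>
    (intervalIntegrable_const (c := c⁻¹)).mono_fun hm.inv.aestronglyMeasurable
      (Eventually.of_forall fun φ => by
        change ‖(m φ)⁻¹‖ ≤ ‖c⁻¹‖
        rw [Real.norm_of_nonneg (inv_pos.2 (hmpos φ)).le, Real.norm_of_nonneg (inv_pos.2 hc).le]
        exact inv_anti₀ hc (hcm φ))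
  -- `τ θ` is the time at which angle `θ` is reached when `dθ/dt = m θ`. As `m` may be
  -- discontinuous, this equation is solved by inverting `τ`.
  set τ : ℝ → ℝ := fun θ => ∫ φ in θ₀..θ, (m φ)⁻¹ with hτ
  have hsub : ∀ a b, τ b - τ a = ∫ φ in a..b, (m φ)⁻¹ := fun a b =>
    intervalIntegral.integral_interval_sub_left (hint _ _) (hint _ _)
  have hlow : ∀ a b, a ≤ b → C⁻¹ * (b - a) ≤ τ b - τ a := by
    intro a b hab
    rw [hsub]
    have := intervalIntegral.integral_mono_on (f := fun _ => C⁻¹) hab intervalIntegrable_const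
      (hint a b) fun φ _ => inv_anti₀ (hmpos φ) (hmC φ)
    rw [intervalIntegral.integral_const, smul_eq_mul] at this
    linarith
  have hmono : StrictMono τ := fun a b hab => by
    have := hlow a b hab.le
    have h2 : 0 < C⁻¹ * (b - a) := mul_pos (inv_pos.2 hCpos) (sub_pos.2 hab)
    linarith
  have hτc : Continuous τ := intervalIntegral.continuous_primitive hint θ₀
  have hτ0 : τ θ₀ = 0 := intervalIntegral.integral_same
  have htop : Tendsto τ atTop atTop := by
    refine tendsto_atTop_mono' atTop (f₁ := fun θ => C⁻¹ * (θ - θ₀)) ?_ ?_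
    · filter_upwards [eventually_ge_atTop θ₀] with θ hθ
      have := hlow θ₀ θ hθ
      rwa [hτ0, sub_zero] at this
    · exact (tendsto_atTop_add_const_right _ _ tendsto_id).const_mul_atTop (inv_pos.2 hCpos)
  have hbot : Tendsto τ atBot atBot := by
    refine tendsto_atBot_mono' atBot (f₁ := fun θ => C⁻¹ * (θ - θ₀)) ?_ ?_
    · filter_upwards [eventually_le_atBot θ₀] with θ hθ
      have := hlow θ θ₀ hθ
      rw [hτ0] at this
      linarith
    · exact (tendsto_atBot_add_const_right _ _ tendsto_id).const_mul_atBot (inv_pos.2 hCpos)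
  set e : ℝ ≃o ℝ := hmono.orderIsoOfSurjective τ (hτc.surjective htop hbot)
  have he : ∀ θ, e θ = τ θ := fun θ => rfl
  set Θ : ℝ → ℝ := fun t => e.symm t
  have hΘτ : ∀ θ, Θ (τ θ) = θ := fun θ => e.symm_apply_apply θ
  have hτΘ : ∀ t, τ (Θ t) = t := fun t => e.apply_symm_apply t
  have hΘc : Continuous Θ := e.symm.continuous
  -- The image of Lebesgue measure under `Θ` has density `1/m`, as intervals show. This gives the
  -- change of variables without differentiating `Θ`.
  have hmap : Measure.map Θ volume = volume.withDensity fun φ => ENNReal.ofReal (m φ)⁻¹ := by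
    refine Measure.ext_of_Ioc' _ _ (fun a b _ => ?_) fun a b hab => ?_
    · rw [Measure.map_apply hΘc.measurable measurableSet_Ioc]
      have : Θ ⁻¹' Ioc a b = Ioc (τ a) (τ b) := by
        ext t
        simp only [mem_preimage, mem_Ioc]
        rw [← hmono.lt_iff_lt (a := a), ← hmono.le_iff_le (b := b), hτΘ]
      rw [this, Real.volume_Ioc]
      exact ENNReal.ofReal_ne_top
    · rw [Measure.map_apply hΘc.measurable measurableSet_Ioc]
      have : Θ ⁻¹' Ioc a b = Ioc (τ a) (τ b) := by
        ext t
        simp only [mem_preimage, mem_Ioc]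
        rw [← hmono.lt_iff_lt (a := a), ← hmono.le_iff_le (b := b), hτΘ]
      rw [this, Real.volume_Ioc, withDensity_apply _ measurableSet_Ioc, hsub,
        intervalIntegral.integral_of_le hab.le,
        ofReal_integral_eq_lintegral_ofReal (hint a b).1
          (Eventually.of_forall fun φ => (inv_pos.2 (hmpos φ)).le)]
  refine ⟨Θ, hΘc, e.symm.strictMono, by rw [← hτ0]; exact hΘτ θ₀, hΘτ, hτΘ, fun F t ht => ?_⟩
  have hΘ0 : Θ 0 = θ₀ := by rw [← hτ0]; exact hΘτ θ₀
  have hle : θ₀ ≤ Θ t := hΘ0 ▸ e.symm.monotone ht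
  rw [intervalIntegral.integral_of_le ht, intervalIntegral.integral_of_le hle]
  have hpre : Ioc 0 t = Θ ⁻¹' Ioc θ₀ (Θ t) := by
    ext s
    simp only [mem_preimage, mem_Ioc]
    rw [← hΘ0, e.symm.lt_iff_lt, e.symm.le_iff_le]
  have hemb : MeasurableEmbedding Θ := e.symm.toHomeomorph.measurableEmbedding
  rw [hpre, ← hemb.setIntegral_map, hmap,
    setIntegral_withDensity_eq_setIntegral_toReal_smul (by fun_prop)
      (Eventually.of_forall fun φ => ENNReal.ofReal_lt_top) _ measurableSet_Ioc]
  refine integral_congr_ae (Eventually.of_forall fun φ => ?_)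
  simp only [ENNReal.toReal_ofReal (inv_pos.2 (hmpos φ)).le, Complex.real_smul]

/-! ### Measurable selection of maximizers -/

section Selection

variable {K : Type*}

/-- The maximizers of `f (θ, ·)` on `F θ`. -/
def argmaxCorr (f : ℝ × K → ℝ) (F : ℝ → Set K) (θ : ℝ) : Set K :=
  {k ∈ F θ | ∀ k' ∈ F θ, f (θ, k') ≤ f (θ, k)}

theorem argmaxCorr_congr {F : ℝ → Set K} {f : ℝ × K → ℝ} {θ θ' : ℝ} (hF : F θ = F θ')
    (hf : ∀ k, f (θ, k) = f (θ', k)) : argmaxCorr f F θ = argmaxCorr f F θ' := by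
  ext k; simp [argmaxCorr, hF, hf]

variable [TopologicalSpace K] [CompactSpace K]

/-- Closed nonempty valued correspondences all of whose lower preimages of closed sets are
measurable. -/
structure MeasCorr (F : ℝ → Set K) : Prop where
  closed : ∀ θ, IsClosed (F θ)
  nonempty : ∀ θ, (F θ).Nonempty
  measurable : ∀ C : Set (ℝ × K), IsClosed C → MeasurableSet {θ | ∃ k ∈ F θ, (θ, k) ∈ C}

theorem MeasCorr.univ [Nonempty K] : MeasCorr fun _ : ℝ => (Set.univ : Set K) := by
  refine ⟨fun _ => isClosed_univ, fun _ => univ_nonempty, fun C hC => ?_⟩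
  have : {θ : ℝ | ∃ k ∈ (Set.univ : Set K), (θ, k) ∈ C} = Prod.fst '' C := by
    ext θ; simp
  rw [this]
  exact (isClosedMap_fst_of_compactSpace C hC).measurableSet

/-- The set of maximizers meets `C` exactly when, for every rational `r`, either `f < r` on all of
`F θ` or `F θ` meets `C ∩ {f ≥ r}`. Compactness yields a point of `C` attaining the maximum, so
countably many measurable conditions suffice. -/
theorem MeasCorr.argmax {F : ℝ → Set K} (hF : MeasCorr F) {f : ℝ × K → ℝ} (hf : Continuous f) :
    MeasCorr (argmaxCorr f F) := by
  have hfθ : ∀ θ, Continuous fun k => f (θ, k) := fun θ => hf.comp (by fun_prop)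
  have hclosed : ∀ θ, IsClosed (argmaxCorr f F θ) := by
    intro θ
    have : argmaxCorr f F θ = F θ ∩ ⋂ k' ∈ F θ, {k | f (θ, k') ≤ f (θ, k)} := by
      ext k; simp [argmaxCorr]
    rw [this]
    exact (hF.closed θ).inter (isClosed_biInter fun k' _ => isClosed_le continuous_const (hfθ θ))
  refine ⟨hclosed, fun θ => ?_, fun C hC => ?_⟩
  · obtain ⟨k, hk, hmax⟩ := (hF.closed θ).isCompact.exists_isMaxOn (hF.nonempty θ)
      (hfθ θ).continuousOn
    exact ⟨k, hk, fun k' hk' => hmax hk'⟩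
  · have : {θ | ∃ k ∈ argmaxCorr f F θ, (θ, k) ∈ C} = ⋂ r : ℚ,
        ({θ | ∃ k ∈ F θ, (θ, k) ∈ {p : ℝ × K | (r : ℝ) ≤ f p}}ᶜ ∪
          {θ | ∃ k ∈ F θ, (θ, k) ∈ C ∩ {p : ℝ × K | (r : ℝ) ≤ f p}}) := by
      ext θ
      simp only [mem_iInter, mem_union, mem_compl_iff, mem_ofPred_eq, mem_inter_iff]
      constructor
      · rintro ⟨k, ⟨hk, hmax⟩, hkC⟩ r
        by_cases h : ∃ k ∈ F θ, (r : ℝ) ≤ f (θ, k)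
        · obtain ⟨k', hk', hr⟩ := h
          exact Or.inr ⟨k, hk, hkC, hr.trans (hmax k' hk')⟩
        · exact Or.inl h
      · intro h
        obtain ⟨k₁, hk₁, hmax⟩ := (hF.closed θ).isCompact.exists_isMaxOn (hF.nonempty θ)
          (hfθ θ).continuousOn
        have h' : ∀ r : ℚ, (r : ℝ) ≤ f (θ, k₁) → ∃ k ∈ F θ, (θ, k) ∈ C ∧ (r : ℝ) ≤ f (θ, k) :=
          fun r hr => (h r).resolve_left fun hn => hn ⟨k₁, hk₁, hr⟩
        have hG : IsCompact (F θ ∩ {k | (θ, k) ∈ C}) :=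
          ((hF.closed θ).inter (hC.preimage (by fun_prop))).isCompact
        obtain ⟨r, hr⟩ := exists_rat_lt (f (θ, k₁))
        obtain ⟨k₂, hk₂, hk₂C, -⟩ := h' r hr.le
        obtain ⟨k, ⟨hk, hkC⟩, hkmax⟩ := hG.exists_isMaxOn ⟨k₂, hk₂, hk₂C⟩ (hfθ θ).continuousOn
        refine ⟨k, ⟨hk, fun k' hk' => (hmax hk').trans ?_⟩, hkC⟩
        by_contra hlt
        obtain ⟨r, hr1, hr2⟩ := exists_rat_btwn (not_le.1 hlt)
        obtain ⟨k₃, hk₃, hk₃C, hr3⟩ := h' r hr2.le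
        have := hkmax (⟨hk₃, hk₃C⟩ : k₃ ∈ F θ ∩ {k | (θ, k) ∈ C})
        simp only [mem_ofPred_eq] at this
        linarith
    rw [this]
    refine MeasurableSet.iInter fun r => (hF.measurable _ ?_).compl.union (hF.measurable _ ?_)
    · exact isClosed_le continuous_const hf
    · exact hC.inter (isClosed_le continuous_const hf)

end Selection

/-- Measurable selection for correspondences into a compact set of matrices. -/
theorem MeasCorr.exists_selection {𝒜 : Set Mat2} (hcompact : IsCompact 𝒜) {F : ℝ → Set 𝒜}
    (hF : have := isCompact_iff_compactSpace.1 hcompact; MeasCorr F) :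
    ∃ s : ℝ → 𝒜, (∀ θ, s θ ∈ F θ) ∧ (∀ i j, Measurable fun θ => (s θ).1 i j) ∧
      ∀ θ θ', F θ = F θ' → s θ = s θ' := by
  have := isCompact_iff_compactSpace.1 hcompact
  set e : Fin 2 → Fin 2 → ℝ × 𝒜 → ℝ := fun i j p => p.2.1 i j with he
  have hec : ∀ i j, Continuous (e i j) := fun i j => by
    have h1 : Continuous fun A : Mat2 => A i j := by fun_prop
    exact h1.comp (continuous_subtype_val.comp continuous_snd)
  -- Maximizing the four entries lexicographically leaves a single matrix. It depends only on the
  -- set `F θ`, so the selection inherits every period of `F`.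
  set G := argmaxCorr (e 1 1) (argmaxCorr (e 1 0) (argmaxCorr (e 0 1) (argmaxCorr (e 0 0) F)))
  have hG : MeasCorr G :=
    (((hF.argmax (hec 0 0)).argmax (hec 0 1)).argmax (hec 1 0)).argmax (hec 1 1)
  have huniq : ∀ θ, ∀ a ∈ G θ, ∀ b ∈ G θ, a = b := by
    rintro θ a ⟨⟨⟨⟨ha, ha00⟩, ha01⟩, ha10⟩, ha11⟩ b ⟨⟨⟨⟨hb, hb00⟩, hb01⟩, hb10⟩, hb11⟩
    apply Subtype.ext
    ext i j
    fin_cases i <;> fin_cases j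
    · exact le_antisymm (hb00 a ha) (ha00 b hb)
    · exact le_antisymm (hb01 a ⟨ha, ha00⟩) (ha01 b ⟨hb, hb00⟩)
    · exact le_antisymm (hb10 a ⟨⟨ha, ha00⟩, ha01⟩) (ha10 b ⟨⟨hb, hb00⟩, hb01⟩)
    · exact le_antisymm (hb11 a ⟨⟨⟨ha, ha00⟩, ha01⟩, ha10⟩) (ha11 b ⟨⟨⟨hb, hb00⟩, hb01⟩, hb10⟩)
  choose s hs using hG.nonempty
  refine ⟨s, fun θ => (hs θ).1.1.1.1, fun i j => measurable_of_Ici fun r => ?_, fun θ θ' h => ?_⟩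
  · have : (fun θ => (s θ).1 i j) ⁻¹' Ici r = {θ | ∃ k ∈ G θ, (θ, k) ∈ {p | r ≤ e i j p}} := by
      ext θ
      constructor
      · intro h; exact ⟨s θ, hs θ, h⟩
      · rintro ⟨k, hk, hr⟩
        rw [huniq θ k hk _ (hs θ)] at hr
        exact hr
    rw [this]
    exact hG.measurable _ (isClosed_le continuous_const (hec i j))
  · have : G θ = G θ' := by
      refine argmaxCorr_congr (argmaxCorr_congr (argmaxCorr_congr (argmaxCorr_congr h ?_) ?_) ?_) ?_
        <;> intro k <;> rfl
    exact huniq θ' _ (this ▸ hs θ) _ (hs θ')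

/-! ### Arguments of `-A u / u` and their extremes -/

/-- A real quotient in the direction `e^{iθ}` is an eigenvalue with that eigenvector. -/
theorem hullHasNonnegEigenvalue_of_dirQuot {𝒜 : Set Mat2} {B : Mat2}
    (hB : B ∈ convexHull ℝ 𝒜) {θ : ℝ} (him : (dirQuot B θ).im = 0) (hre : 0 ≤ (dirQuot B θ).re) :
    HullHasNonnegEigenvalue 𝒜 := by
  refine ⟨B, hB, (dirQuot B θ).re, hre, ?_⟩
  set u : ℂ := Complex.exp (θ * Complex.I)
  have hu : u ≠ 0 := Complex.exp_ne_zero _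
  refine Module.End.hasEigenvalue_of_hasEigenvector (x := toCL.symm u) ⟨?_, ?_⟩
  · rw [Module.End.mem_eigenspace_iff, Matrix.toLin'_apply]
    apply toC_injective
    rw [toC_mulVec, toC_smul, toC_symm_apply]
    have h1 := opC_polar B 1 θ
    rw [Complex.ofReal_one, one_mul] at h1
    rw [h1]
    congr 1
    exact Complex.ext rfl (by simp [him])
  · intro h0
    exact hu (toCL.symm.map_eq_zero_iff.1 h0)

/-- The sign moves the forbidden half-line of eigenvalues `≥ 0` onto the branch cut of `arg`, so
`arg (-q)` is continuous in the matrix and the direction. -/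
theorem neg_dirQuot_mem_slitPlane {𝒜 : Set Mat2} (h : ¬ HullHasNonnegEigenvalue 𝒜) {B : Mat2}
    (hB : B ∈ convexHull ℝ 𝒜) (θ : ℝ) : -dirQuot B θ ∈ Complex.slitPlane := by
  by_contra hn
  rw [Complex.mem_slitPlane_iff, not_or, not_lt, not_not] at hn
  refine h (hullHasNonnegEigenvalue_of_dirQuot hB (θ := θ) ?_ ?_)
  · simpa using hn.2
  · simpa using hn.1

theorem dirQuot_combo (A B : Mat2) (a b θ : ℝ) :
    dirQuot (a • A + b • B) θ = a * dirQuot A θ + b * dirQuot B θ := by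
  simp [dirQuot, holPart, antiPart]; ring

/-- The angular width of a convex set avoiding the nonpositive half-line is less than `π`. -/
theorem arg_sub_arg_lt_pi {w₁ w₂ : ℂ} (h₁ : w₁ ∈ Complex.slitPlane) (h₂ : w₂ ∈ Complex.slitPlane)
    (h : ∀ a b : ℝ, 0 ≤ a → 0 ≤ b → a + b = 1 → (a * w₁ + b * w₂ : ℂ) ∈ Complex.slitPlane) :
    w₂.arg - w₁.arg < Real.pi := by
  by_contra hn
  push Not at hn
  have l1 := Complex.neg_pi_lt_arg w₁
  have u2 := (Complex.arg_le_pi w₂).lt_of_ne (Complex.mem_slitPlane_iff_arg.1 h₂).1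
  have hw1 : w₁.arg < 0 := by linarith
  have hw2 : 0 < w₂.arg := by linarith
  have i1 : w₁.im < 0 := Complex.arg_neg_iff.1 hw1
  have i2 : 0 < w₂.im := by
    exact im_pos_of_arg_mem ⟨hw2, u2⟩
  have hd : 0 < w₂.im - w₁.im := by linarith
  -- These weights give the point where the segment crosses the real axis. Its real part has the
  -- sign of `sin (w₂.arg - w₁.arg)`, which an angular gap of `π` or more makes nonpositive.
  have hm := h (w₂.im / (w₂.im - w₁.im)) (-w₁.im / (w₂.im - w₁.im)) (by positivity)
    (div_nonneg (by linarith) hd.le) (by field_simp; ring)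
  rw [Complex.mem_slitPlane_iff] at hm
  have n1 : 0 < ‖w₁‖ := norm_pos_iff.2 (Complex.slitPlane_ne_zero h₁)
  have n2 : 0 < ‖w₂‖ := norm_pos_iff.2 (Complex.slitPlane_ne_zero h₂)
  have hs : Real.sin (w₂.arg - w₁.arg) ≤ 0 := by
    have := Real.sin_nonneg_of_nonneg_of_le_pi (x := w₂.arg - w₁.arg - Real.pi) (by linarith)
      (by linarith)
    rw [Real.sin_sub_pi] at this
    linarith
  rw [Real.sin_sub, Complex.sin_arg, Complex.sin_arg,
    Complex.cos_arg (Complex.slitPlane_ne_zero h₁), Complex.cos_arg (Complex.slitPlane_ne_zero h₂),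
    div_mul_div_comm, div_mul_div_comm, mul_comm ‖w₂‖, ← sub_div,
    div_le_iff₀ (by positivity), zero_mul] at hs
  rcases hm with hm | hm
  · have e : ((w₂.im / (w₂.im - w₁.im) : ℝ) * w₁ + (-w₁.im / (w₂.im - w₁.im) : ℝ) * w₂ : ℂ).re
        = (w₂.im * w₁.re - w₂.re * w₁.im) / (w₂.im - w₁.im) := by
      simp only [Complex.add_re, Complex.re_ofReal_mul]; ring
    rw [e] at hm
    exact absurd hm (not_lt.2 (div_nonpos_of_nonpos_of_nonneg hs hd.le))
  · apply hm
    simp only [Complex.add_im, Complex.im_ofReal_mul]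
    ring

/-- The extremal arguments of `-A u / u` over `A ∈ 𝒜`. -/
theorem exists_extremal_angles {𝒜 : Set Mat2} (hcompact : IsCompact 𝒜) (hne : 𝒜.Nonempty)
    (h : ¬ HullHasNonnegEigenvalue 𝒜) :
    ∃ α β : ℝ → ℝ, Continuous α ∧ Continuous β ∧ Function.Periodic α Real.pi ∧
      Function.Periodic β Real.pi ∧
      (∀ θ, ∀ A ∈ 𝒜, α θ ≤ (-dirQuot A θ).arg ∧ (-dirQuot A θ).arg ≤ β θ) ∧
      (∀ θ, ∃ A ∈ 𝒜, (-dirQuot A θ).arg = α θ) ∧ ∀ θ, ∃ A ∈ 𝒜, (-dirQuot A θ).arg = β θ := by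
  have := isCompact_iff_compactSpace.1 hcompact
  have := hne.to_subtype
  have hc : Continuous fun p : ℝ × 𝒜 => (-dirQuot p.2.1 p.1).arg := by
    rw [continuous_iff_continuousAt]
    intro p
    refine ContinuousAt.comp (g := Complex.arg) (Complex.continuousAt_arg
      (neg_dirQuot_mem_slitPlane h (subset_convexHull ℝ _ p.2.2) p.1)) ?_
    have : Continuous fun p : ℝ × 𝒜 => dirQuot p.2.1 p.1 :=
      continuous_dirQuot.comp ((continuous_subtype_val.comp continuous_snd).prodMk continuous_fst)
    exact this.neg.continuousAt
  set f : ℝ → 𝒜 → ℝ := fun θ A => (-dirQuot A.1 θ).arg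
  have hfθ : ∀ θ, Continuous (f θ) := fun θ => hc.comp (by fun_prop : Continuous fun A => (θ, A))
  have hcompf : ∀ θ, IsCompact (f θ '' univ) := fun θ => isCompact_univ.image (hfθ θ)
  have hle : ∀ θ, ∀ A ∈ 𝒜, sInf (f θ '' univ) ≤ (-dirQuot A θ).arg ∧
      (-dirQuot A θ).arg ≤ sSup (f θ '' univ) := fun θ A hA =>
    ⟨csInf_le (hcompf θ).bddBelow ⟨⟨A, hA⟩, trivial, rfl⟩,
      le_csSup (hcompf θ).bddAbove ⟨⟨A, hA⟩, trivial, rfl⟩⟩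
  have hat1 : ∀ θ, ∃ A ∈ 𝒜, (-dirQuot A θ).arg = sInf (f θ '' univ) := fun θ => by
    obtain ⟨A, -, hA⟩ := (hcompf θ).sInf_mem (univ_nonempty.image _)
    exact ⟨A.1, A.2, hA⟩
  have hat2 : ∀ θ, ∃ A ∈ 𝒜, (-dirQuot A θ).arg = sSup (f θ '' univ) := fun θ => by
    obtain ⟨A, -, hA⟩ := (hcompf θ).sSup_mem (univ_nonempty.image _)
    exact ⟨A.1, A.2, hA⟩
  have hper : ∀ θ, f (θ + Real.pi) = f θ := fun θ => by
    funext A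
    simp only [f, dirQuot_add_pi]
  exact ⟨fun θ => sInf (f θ '' univ), fun θ => sSup (f θ '' univ),
    isCompact_univ.continuous_sInf hc, isCompact_univ.continuous_sSup hc,
    fun θ => by simp only [hper], fun θ => by simp only [hper], hle, hat1, hat2⟩

theorem exists_norm_dirQuot_lower {𝒜 : Set Mat2} (hcompact : IsCompact 𝒜) (hne : 𝒜.Nonempty)
    (h : ∀ A ∈ 𝒜, ∀ θ, dirQuot A θ ≠ 0) : ∃ δ > 0, ∀ A ∈ 𝒜, ∀ θ, δ ≤ ‖dirQuot A θ‖ := by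
  obtain ⟨A₀, hA₀⟩ := hne
  obtain ⟨p, hp, hmin⟩ := (hcompact.prod (isCompact_Icc (a := (0 : ℝ)) (b := Real.pi)))
    |>.exists_isMinOn ⟨(A₀, 0), hA₀, by simp [Real.pi_pos.le]⟩ continuous_dirQuot.norm.continuousOn
  refine ⟨‖dirQuot p.1 p.2‖, norm_pos_iff.2 (h _ hp.1 _), fun B hB θ => ?_⟩
  have hP : Function.Periodic (fun θ => dirQuot B θ) Real.pi := dirQuot_add_pi B
  obtain ⟨y, hy, hey⟩ := hP.exists_mem_Ico₀ Real.pi_pos θ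
  rw [hey]
  exact hmin (a := (B, y)) ⟨hB, hy.1, hy.2.le⟩

/-- The addition formula for cosine. With `w = -q` and slope `tan γ`, where `|γ| < π/2`,
admissibility becomes the angular condition `cos (arg w + γ) > 0`. -/
theorem re_sub_tan_mul_im {w : ℂ} (hw : w ≠ 0) {γ : ℝ} (hγ : Real.cos γ ≠ 0) :
    w.re - Real.tan γ * w.im = ‖w‖ * Real.cos (w.arg + γ) / Real.cos γ := by
  have h1 : w.re = ‖w‖ * Real.cos w.arg := by
    rw [Complex.cos_arg hw, mul_div_cancel₀ _ (norm_ne_zero_iff.2 hw)]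
  have h2 : w.im = ‖w‖ * Real.sin w.arg := by
    rw [Complex.sin_arg, mul_div_cancel₀ _ (norm_ne_zero_iff.2 hw)]
  rw [Real.cos_add, Real.tan_eq_sin_div_cos]
  conv_lhs => rw [h1, h2]
  field_simp

/-! ### Admissible slope fields and the leading left trajectory -/

/-- A continuous `π`-periodic slope field strictly separating the left and right slopes. -/
structure Admissible (𝒜 : Set Mat2) (g : ℝ → ℝ) : Prop where
  continuous : Continuous g
  periodic : Function.Periodic g Real.pi
  lt : ∀ A ∈ 𝒜, ∀ θ, (dirQuot A θ).re - g θ * (dirQuot A θ).im < 0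

/-- The condition is affine in the slope. Only one of the two fields has to satisfy it strictly, so
the extremal slope itself may serve as `g₁`. -/
theorem Admissible.combo {𝒜 : Set Mat2} {g₁ g₂ : ℝ → ℝ} (h₁ : Continuous g₁)
    (hp₁ : Function.Periodic g₁ Real.pi)
    (hle : ∀ A ∈ 𝒜, ∀ θ, (dirQuot A θ).re - g₁ θ * (dirQuot A θ).im ≤ 0) (h₂ : Admissible 𝒜 g₂)
    {s : ℝ} (hs : 0 < s) (hs1 : s ≤ 1) : Admissible 𝒜 fun θ => (1 - s) * g₁ θ + s * g₂ θ := by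
  have hc := h₂.continuous
  refine ⟨by fun_prop, fun θ => by simp only [hp₁ θ, h₂.periodic θ], fun A hA θ => ?_⟩
  have l1 := mul_nonneg (sub_nonneg.2 hs1) (neg_nonneg.2 (hle A hA θ))
  have l2 := mul_pos hs (neg_pos.2 (h₂.lt A hA θ))
  nlinarith

theorem integral_combo {g₁ g₂ : ℝ → ℝ} (h₁ : Continuous g₁) (h₂ : Continuous g₂) (s a b : ℝ) :
    ∫ θ in a..b, ((1 - s) * g₁ θ + s * g₂ θ) =
      (1 - s) * (∫ θ in a..b, g₁ θ) + s * ∫ θ in a..b, g₂ θ := by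
  rw [intervalIntegral.integral_add, intervalIntegral.integral_const_mul,
    intervalIntegral.integral_const_mul] <;>
  · apply Continuous.intervalIntegrable
    fun_prop

/-- If some matrix turns left at every direction, the leading left trajectory from any point is
round, with factor the exponential of the integral of the extremal slopes. -/
theorem exists_isRoundLeft {𝒜 : Set Mat2} (hcompact : IsCompact 𝒜) (hne : 𝒜.Nonempty)
    (hslit : ∀ A ∈ 𝒜, ∀ θ, -dirQuot A θ ∈ Complex.slitPlane) {α : ℝ → ℝ} (hα : Continuous α)
    (hαp : Function.Periodic α Real.pi) (hαle : ∀ θ, ∀ A ∈ 𝒜, α θ ≤ (-dirQuot A θ).arg)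
    (hαat : ∀ θ, ∃ A ∈ 𝒜, (-dirQuot A θ).arg = α θ) (hαneg : ∀ θ, α θ < 0) {x₀ : Vec2}
    (hx₀ : x₀ ≠ 0) :
    ∃ A x T, x 0 = x₀ ∧ IsRoundLeft 𝒜 A x T
      (Real.exp (∫ θ in (0 : ℝ)..Real.pi, Real.tan (-(Real.pi / 2) - α θ))) := by
  have := isCompact_iff_compactSpace.1 hcompact
  have := hne.to_subtype
  have hαgt : ∀ θ, -Real.pi < α θ := fun θ => by
    obtain ⟨A, -, hA⟩ := hαat θ
    exact hA ▸ Complex.neg_pi_lt_arg _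
  have hq0 : ∀ A ∈ 𝒜, ∀ θ, dirQuot A θ ≠ 0 := fun A hA θ =>
    neg_ne_zero.1 (Complex.slitPlane_ne_zero (hslit A hA θ))
  -- the slope
  set a : ℝ → ℝ := fun θ => Real.tan (-(Real.pi / 2) - α θ) with ha
  have hcos : ∀ θ, 0 < Real.cos (-(Real.pi / 2) - α θ) := fun θ =>
    Real.cos_pos_of_mem_Ioo ⟨by linarith [hαneg θ], by linarith [hαgt θ]⟩
  have hac : Continuous a := by
    rw [continuous_iff_continuousAt]
    intro θ
    exact (Real.continuousAt_tan.2 (hcos θ).ne').comp (f := fun θ => -(Real.pi / 2) - α θ)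
      (by fun_prop)
  have hap : Function.Periodic a Real.pi := fun θ => by simp only [ha, hαp θ]
  obtain ⟨Am, hAm⟩ : ∃ K, ∀ θ, |a θ| ≤ K := by
    obtain ⟨K, hK⟩ := (isCompact_Icc (a := (0 : ℝ)) (b := Real.pi)).exists_bound_of_continuousOn
      hac.continuousOn
    refine ⟨K, fun θ => ?_⟩
    obtain ⟨y, hy, hey⟩ := hap.exists_mem_Ico₀ Real.pi_pos θ
    rw [hey]
    exact hK y ⟨hy.1, hy.2.le⟩
  -- the selection
  have hqc : Continuous fun p : ℝ × 𝒜 => dirQuot p.2.1 p.1 :=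
    continuous_dirQuot.comp ((continuous_subtype_val.comp continuous_snd).prodMk continuous_fst)
  have hargc : Continuous fun p : ℝ × 𝒜 => -(-dirQuot p.2.1 p.1).arg := by
    rw [continuous_iff_continuousAt]
    intro p
    exact (ContinuousAt.comp (g := Complex.arg) (f := fun p : ℝ × 𝒜 => -dirQuot p.2.1 p.1) (Complex.continuousAt_arg
      (hslit p.2.1 p.2.2 p.1)) hqc.neg.continuousAt).neg
  -- Least argument of `-q` first, then greatest modulus: for left-turning matrices `arg q = arg
  -- (-q) + π`, so this is the leading left choice as a function of direction.
  obtain ⟨σ, hσF, hσm, hσper⟩ := MeasCorr.exists_selection hcompact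
    ((MeasCorr.univ.argmax hargc).argmax hqc.norm)
  have hσα : ∀ θ, (-dirQuot (σ θ).1 θ).arg = α θ := by
    intro θ
    obtain ⟨A, hA, hAe⟩ := hαat θ
    have h1 := (hσF θ).1.2 ⟨A, hA⟩ trivial
    simp only [hAe] at h1
    exact le_antisymm (by linarith) (hαle θ _ (σ θ).2)
  have hσn : ∀ θ, ∀ B ∈ 𝒜, (-dirQuot B θ).arg = α θ → ‖dirQuot B θ‖ ≤ ‖dirQuot (σ θ).1 θ‖ := by
    intro θ B hB hBe
    refine (hσF θ).2 ⟨B, hB⟩ ⟨trivial, fun k _ => ?_⟩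
    simp only [hBe]
    exact neg_le_neg (hαle θ _ k.2)
  have hσp : ∀ θ, σ (θ + Real.pi) = σ θ := by
    intro θ
    apply hσper
    refine argmaxCorr_congr (argmaxCorr_congr rfl fun k => ?_) fun k => ?_ <;>
      simp only [dirQuot_add_pi]
  -- the angular speed
  set m : ℝ → ℝ := fun θ => (dirQuot (σ θ).1 θ).im with hmdef
  have hmm : Measurable m := by
    have h00 := hσm 0 0
    have h01 := hσm 0 1
    have h10 := hσm 1 0
    have h11 := hσm 1 1
    simp only [hmdef, dirQuot, holPart, antiPart]
    fun_prop
  have hmp : ∀ θ, m (θ + Real.pi) = m θ := fun θ => by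
    simp only [hmdef, hσp, dirQuot_add_pi]
  have hmpos : ∀ θ, 0 < m θ := by
    intro θ
    have : (-dirQuot (σ θ).1 θ).im < 0 := by
      rw [← Complex.arg_neg_iff, hσα]
      exact hαneg θ
    simpa using this
  -- For the extremal argument the cosine in `re_sub_tan_mul_im` is `cos (-π/2) = 0`. Thus `a` is
  -- the slope `d(log r)/dθ` of the selected law, and `m` its angular speed.
  have hqm : ∀ θ, dirQuot (σ θ).1 θ = (a θ + Complex.I) * m θ := by
    intro θ
    have h1 := re_sub_tan_mul_im (neg_ne_zero.2 (hq0 _ (σ θ).2 θ)) (hcos θ).ne'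
    rw [hσα, add_sub_cancel, Real.cos_neg, Real.cos_pi_div_two, mul_zero, zero_div,
      Complex.neg_re, Complex.neg_im] at h1
    apply Complex.ext
    · simp only [hmdef, ha, Complex.mul_re, Complex.add_re, Complex.ofReal_re, Complex.I_re,
        Complex.ofReal_im, mul_zero, sub_zero, add_zero]
      linarith
    · simp [hmdef]
  obtain ⟨M, hM0, hM, hMq⟩ := exists_opC_bound hcompact
  obtain ⟨δ, hδ, hδq⟩ := exists_norm_dirQuot_lower hcompact hne hq0
  have hAm0 : 0 ≤ Am := (abs_nonneg _).trans (hAm 0)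
  have hmlow : ∀ θ, δ / (Am + 1) ≤ m θ := by
    intro θ
    rw [div_le_iff₀ (by linarith)]
    have h1 := hδq _ (σ θ).2 θ
    rw [hqm, norm_mul, Complex.norm_real, Real.norm_of_nonneg (hmpos θ).le] at h1
    have h2 : ‖(a θ + Complex.I : ℂ)‖ ≤ Am + 1 := by
      refine (norm_add_le _ _).trans ?_
      rw [Complex.norm_real, Complex.norm_I]
      exact add_le_add (hAm θ) le_rfl
    rw [mul_comm]
    exact h1.trans (mul_le_mul_of_nonneg_right h2 (hmpos θ).le)
  have hmup : ∀ θ, m θ ≤ M := fun θ =>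
    (le_abs_self _).trans ((Complex.abs_im_le_norm _).trans (hMq _ (σ θ).2 θ))
  set z₀ := toC x₀
  have hz₀ : z₀ ≠ 0 := fun h0 => hx₀ (toC_eq_zero.1 h0)
  set θ₀ := z₀.arg
  obtain ⟨Θ, hΘc, hΘm, hΘ0, hΘτ, hτΘ, hΘint⟩ := exists_time_change hmm
    (div_pos hδ (by linarith)) hmlow hmup θ₀
  have hmint : ∀ u v, IntervalIntegrable (fun φ => (m φ)⁻¹) volume u v := fun u v =>
    (intervalIntegrable_const (c := (δ / (Am + 1))⁻¹)).mono_fun hmm.inv.aestronglyMeasurable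
      (Eventually.of_forall fun φ => by
        change ‖(m φ)⁻¹‖ ≤ ‖(δ / (Am + 1))⁻¹‖
        have hpos : 0 < δ / (Am + 1) := div_pos hδ (by linarith)
        rw [Real.norm_of_nonneg (inv_pos.2 (hmpos φ)).le, Real.norm_of_nonneg (inv_pos.2 hpos).le]
        exact inv_anti₀ hpos (hmlow φ))
  have hinvper : Function.Periodic (fun φ => (m φ)⁻¹) Real.pi := fun φ => by simp only [hmp]
  set T := ∫ φ in θ₀..(θ₀ + Real.pi), (m φ)⁻¹ with hT
  have hΘT : Θ T = θ₀ + Real.pi := hΘτ _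
  have hTpos : 0 < T := by
    rw [← hΘm.lt_iff_lt, hΘT, hΘ0]
    linarith [Real.pi_pos]
  have hΘper : ∀ t, Θ (t + T) = Θ t + Real.pi := by
    intro t
    rw [← hΘτ (Θ t + Real.pi)]
    congr 1
    rw [← intervalIntegral.integral_add_adjacent_intervals (hmint θ₀ (Θ t)) (hmint _ _), hτΘ,
      hinvper.intervalIntegral_add_eq (Θ t) θ₀]
  -- the trajectory
  set R : ℝ → ℝ := fun θ => ‖z₀‖ * Real.exp (∫ φ in θ₀..θ, a φ) with hR
  have hRpos : ∀ θ, 0 < R θ := fun θ => mul_pos (norm_pos_iff.2 hz₀) (Real.exp_pos _)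
  set X : ℝ → ℂ := fun θ => (R θ : ℂ) * Complex.exp (θ * Complex.I) with hX
  have hRd : ∀ θ, HasDerivAt R (a θ * R θ) θ := by
    intro θ
    have h1 : HasDerivAt (fun θ => ∫ φ in θ₀..θ, a φ) (a θ) θ :=
      intervalIntegral.integral_hasDerivAt_right (hac.intervalIntegrable _ _)
        (hac.stronglyMeasurableAtFilter _ _) hac.continuousAt
    refine (h1.exp.const_mul ‖z₀‖).congr_deriv ?_
    simp only [hR]; ring
  have hXd : ∀ θ, HasDerivAt X ((a θ + Complex.I) * X θ) θ := by
    intro θ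
    have h1 : HasDerivAt (fun θ : ℝ => Complex.exp (θ * Complex.I))
        (Complex.exp (θ * Complex.I) * (1 * Complex.I)) θ :=
      ((Complex.ofRealCLM.hasDerivAt (x := θ)).mul_const Complex.I).cexp
    refine ((hRd θ).ofReal_comp.mul h1).congr_deriv ?_
    simp only [hX]; push_cast; ring
  have hXc : Continuous X := continuous_iff_continuousAt.2 fun θ => (hXd θ).continuousAt
  have hX0 : X θ₀ = z₀ := by
    simp only [hX, hR, intervalIntegral.integral_same, Real.exp_zero, mul_one]
    exact Complex.norm_mul_exp_arg_mul_I z₀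
  set x : ℝ → Vec2 := fun t => toCL.symm (X (Θ t)) with hxdef
  have hx0 : x 0 = x₀ := by
    simp only [hxdef, hΘ0, hX0]
    exact toCL.symm_apply_apply x₀
  have hxC : ∀ t, toC (x t) = X (Θ t) := fun t => toC_symm_apply _
  have hquot : ∀ (B : Mat2) t, opC B (X (Θ t)) / X (Θ t) = dirQuot B (Θ t) := by
    intro B t
    simp only [hX]
    rw [opC_polar, mul_div_assoc, div_self, mul_one]
    exact mul_ne_zero (by exact_mod_cast (hRpos _).ne') (Complex.exp_ne_zero _)
  refine ⟨fun t => (σ (Θ t)).1, x, T, hx0, ⟨?_, fun t _ => ?_, ?_⟩⟩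
  · rw [isTrajectory_iff]
    refine ⟨fun i j => (hσm i j).comp hΘc.measurable, fun t _ => (σ _).2, ?_, fun t ht => ?_⟩
    · simp only [hxC]
      exact (hXc.comp hΘc).continuousOn
    · simp only [hxC]
      have e : ∀ s, opC (σ (Θ s)).1 (X (Θ s))
          = (fun φ => (m φ : ℂ) * ((a φ + Complex.I) * X φ)) (Θ s) := by
        intro s
        simp only [hX]
        rw [opC_polar, hqm]
        ring
      simp only [e]
      have hI := hΘint (fun φ => (m φ : ℂ) * ((a φ + Complex.I) * X φ)) t ht
      beta_reduce at hI
      rw [hI]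
      have e2 : ∫ φ in θ₀..(Θ t), (((m φ)⁻¹ : ℝ) : ℂ) * ((m φ : ℂ) * ((a φ + Complex.I) * X φ))
          = ∫ φ in θ₀..(Θ t), (a φ + Complex.I) * X φ := by
        refine intervalIntegral.integral_congr fun φ _ => ?_
        rw [← mul_assoc, ← Complex.ofReal_mul, inv_mul_cancel₀ (hmpos φ).ne', Complex.ofReal_one,
          one_mul]
      rw [e2, intervalIntegral.integral_eq_sub_of_hasDerivAt (fun φ _ => hXd φ)
        (by apply Continuous.intervalIntegrable; fun_prop), hΘ0]
      ring
  · have hor : ∀ B : Mat2, orientedAngle (x t) (B *ᵥ x t) = (dirQuot B (Θ t)).arg := by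
      intro B
      rw [orientedAngle, toC_mulVec, hxC, hquot]
    have hlen : ∀ B : Mat2, euclLength (B *ᵥ x t) = ‖dirQuot B (Θ t)‖ * R (Θ t) := by
      intro B
      rw [euclLength, toC_mulVec, hxC]
      simp only [hX]
      rw [opC_polar, norm_mul, norm_mul, Complex.norm_exp_ofReal_mul_I, mul_one,
        Complex.norm_real, Real.norm_of_nonneg (hRpos _).le]
    have hargneg : ∀ B : Mat2, 0 < (dirQuot B (Θ t)).im →
        (-dirQuot B (Θ t)).arg = (dirQuot B (Θ t)).arg - Real.pi := fun B hB =>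
      Complex.arg_neg_eq_arg_sub_pi_of_im_pos hB
    have hmem : orientedAngle (x t) ((σ (Θ t)).1 *ᵥ x t) ∈ Ioo 0 Real.pi := by
      rw [hor]
      have h1 := hargneg _ (hmpos (Θ t))
      rw [hσα] at h1
      constructor
      · linarith [hαgt (Θ t)]
      · linarith [hαneg (Θ t)]
    refine ⟨?_, (σ _).2, hmem, fun B hB hB' => ?_, fun B hB hB' => ?_⟩
    · rintro ⟨B, hB, c, hc, he⟩
      have h1 := hquot B t
      rw [← hxC, ← toC_mulVec, he, toC_smul, mul_div_assoc, div_self, mul_one] at h1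
      · have h2 := hslit B hB (Θ t)
        rw [← h1, Complex.mem_slitPlane_iff] at h2
        simp at h2
        linarith
      · rw [hxC]
        exact mul_ne_zero (by exact_mod_cast (hRpos _).ne') (Complex.exp_ne_zero _)
    · rw [hor] at hB' ⊢
      rw [hor]
      have h1 := hargneg _ (hmpos (Θ t))
      have h2 := hargneg B (im_pos_of_arg_mem hB')
      have h3 := hαle (Θ t) B hB
      rw [hσα] at h1
      linarith
    · have hB2 := hmem
      rw [← hB', hor] at hB2
      rw [hor, hor] at hB'
      rw [hlen, hlen]
      refine mul_le_mul_of_nonneg_right (hσn _ B hB ?_) (hRpos _).le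
      have h1 := hargneg _ (hmpos (Θ t))
      have h2 := hargneg B (im_pos_of_arg_mem hB2)
      rw [h2, hB', ← h1, hσα]
  · refine ⟨by rw [hx0]; exact hx₀, hTpos, Real.exp_pos _, ?_, ?_, fun t _ => ?_⟩
    · apply toC_injective
      rw [toC_neg, toC_smul, hxC, hxC, hΘT, hΘ0]
      simp only [hX, hR, intervalIntegral.integral_same, Real.exp_zero, mul_one]
      rw [hap.intervalIntegral_add_eq θ₀ 0, zero_add]
      have : Complex.exp (((θ₀ + Real.pi : ℝ) : ℂ) * Complex.I)
          = -Complex.exp (θ₀ * Complex.I) := by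
        rw [Complex.ofReal_add, add_mul, Complex.exp_add, Complex.exp_pi_mul_I]; ring
      rw [this]
      push_cast
      ring
    · rintro s hs hsT ⟨d, hd, he⟩
      have h1 := congrArg toC he
      rw [toC_neg, toC_smul, hxC, hxC, hΘ0] at h1
      simp only [hX] at h1
      have h2 : Complex.exp (((Θ s - θ₀ : ℝ) : ℂ) * Complex.I) = ((-(d * R θ₀ / R (Θ s)) : ℝ) : ℂ) := by
        have hRs : (R (Θ s) : ℂ) ≠ 0 := by exact_mod_cast (hRpos _).ne'
        rw [Complex.ofReal_sub, sub_mul, Complex.exp_sub, div_eq_iff (Complex.exp_ne_zero _)]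
        push_cast
        apply mul_left_cancel₀ hRs
        have h3 : (R (Θ s) : ℂ) * (d * R θ₀ / R (Θ s)) = d * R θ₀ := mul_div_cancel₀ _ hRs
        linear_combination h1 + Complex.exp (θ₀ * Complex.I) * h3
      have h3 := congrArg Complex.im h2
      rw [Complex.exp_ofReal_mul_I_im, Complex.ofReal_im] at h3
      have h4 := hΘm hs
      have h5 := hΘm hsT
      rw [hΘ0] at h4
      rw [hΘT] at h5
      exact absurd h3 (Real.sin_pos_of_pos_of_lt_pi (by linarith) (by linarith)).ne'
    · simp only [hΘper, hσp]

/-! ### An admissible field of negative mean -/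

/-- The logarithm of `-q` has derivative of modulus `2 ‖antiPart A‖ / ‖q‖`, bounded uniformly on the
compact family. A linear modulus of continuity is what makes the integral of the slope diverge
below. -/
theorem exists_arg_dirQuot_lipschitz {𝒜 : Set Mat2} (hcompact : IsCompact 𝒜) (hne : 𝒜.Nonempty)
    (hslit : ∀ A ∈ 𝒜, ∀ θ, -dirQuot A θ ∈ Complex.slitPlane) :
    ∃ K > 0, ∀ A ∈ 𝒜, ∀ θ θ' : ℝ,
      |(-dirQuot A θ).arg - (-dirQuot A θ').arg| ≤ K * |θ - θ'| := by
  obtain ⟨δ, hδ, hδq⟩ := exists_norm_dirQuot_lower hcompact hne fun A hA θ =>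
    neg_ne_zero.1 (Complex.slitPlane_ne_zero (hslit A hA θ))
  obtain ⟨D, hD⟩ := hcompact.exists_bound_of_continuousOn continuous_antiPart.continuousOn
  have hD' : ∀ A ∈ 𝒜, ‖antiPart A‖ ≤ |D| := fun A hA => (hD A hA).trans (le_abs_self D)
  refine ⟨(2 * |D| + 1) / δ, by positivity, fun A hA θ θ' => ?_⟩
  have hd : ∀ φ : ℝ, HasDerivAt (fun φ => Complex.log (-dirQuot A φ))
      (-(antiPart A * (Complex.exp (-(2 * φ : ℝ) * Complex.I) * (-2 * Complex.I)))
        / (-dirQuot A φ)) φ := by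
    intro φ
    have h0 : HasDerivAt (fun φ : ℝ => (-(2 * φ : ℝ) * Complex.I : ℂ)) (-2 * Complex.I) φ := by
      have h := (((hasDerivAt_id φ).const_mul 2).ofReal_comp.neg).mul_const Complex.I
      refine h.congr_deriv ?_
      simp
    exact (((h0.cexp.const_mul (antiPart A)).const_add (holPart A)).neg).clog_real (hslit A hA φ)
  have hb : ∀ φ : ℝ, ‖-(antiPart A * (Complex.exp (-(2 * φ : ℝ) * Complex.I) * (-2 * Complex.I)))
        / (-dirQuot A φ)‖ ≤ (2 * |D| + 1) / δ := by
    intro φ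
    rw [norm_div, norm_neg, norm_neg]
    have h1 : ‖antiPart A * (Complex.exp (-(2 * φ : ℝ) * Complex.I) * (-2 * Complex.I))‖
        = ‖antiPart A‖ * 2 := by
      rw [norm_mul, norm_mul, ← Complex.ofReal_neg, Complex.norm_exp_ofReal_mul_I]
      simp
    rw [h1]
    exact div_le_div₀ (by positivity) (by linarith [hD' A hA]) hδ (hδq A hA φ)
  have := convex_univ.norm_image_sub_le_of_norm_hasDerivWithin_le
    (fun φ _ => (hd φ).hasDerivWithinAt) (fun φ _ => hb φ) (mem_univ θ') (mem_univ θ)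
  rw [Real.norm_eq_abs] at this
  refine le_trans ?_ this
  rw [← Complex.log_im, ← Complex.log_im, ← Complex.sub_im]
  exact Complex.abs_im_le_norm _

/-- With `η = γ + π/2` the tangent is `-cos η / sin η`, where `cos η ≥ 1/2` and `sin η ≤ e`. -/
theorem tan_le_of_near {γ e : ℝ} (h0 : -(Real.pi / 2) < γ) (h1 : γ ≤ -(Real.pi / 2) + e)
    (he : e ≤ 1) : Real.tan γ ≤ -(1 / 2) * e⁻¹ := by
  set η := γ + Real.pi / 2 with hη
  have hη0 : 0 < η := by linarith
  have hηe : η ≤ e := by linarith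
  have e1 : γ = η - Real.pi / 2 := by rw [hη]; ring
  have hsin : 0 < Real.sin η :=
    Real.sin_pos_of_pos_of_lt_pi hη0 (by linarith [Real.pi_gt_three])
  have hsin2 : Real.sin η ≤ e := (Real.sin_le hη0.le).trans hηe
  have hcos : 1 / 2 ≤ Real.cos η := by
    have := Real.one_sub_sq_div_two_le_cos (x := η)
    nlinarith
  rw [Real.tan_eq_sin_div_cos, e1, Real.sin_sub_pi_div_two, Real.cos_sub_pi_div_two, neg_div,
    neg_mul, neg_le_neg_iff, ← div_eq_mul_inv]
  exact div_le_div₀ (by linarith) hcos hsin hsin2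

/-- Slopes are written `tan γ` with `γ` between two continuous bounds, and `γ` is pushed towards the
lower one. The limit is either the slope of the leading left trajectory or contains a nonintegrable
pole to `-∞`. -/
theorem exists_admissible_of_left {𝒜 : Set Mat2} (hcompact : IsCompact 𝒜) (hne : 𝒜.Nonempty)
    (hH : ¬ HullHasNonnegEigenvalue 𝒜) {x₀ : Vec2} (hx₀ : x₀ ≠ 0)
    (hround : ∀ (A : ℝ → Mat2) (x : ℝ → Vec2) (T c : ℝ), x 0 = x₀ →
      IsRoundLeft 𝒜 A x T c → c < 1) :
    ∃ g, Admissible 𝒜 g ∧ ∫ θ in (0 : ℝ)..Real.pi, g θ < 0 := by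
  have hslit : ∀ A ∈ 𝒜, ∀ θ, -dirQuot A θ ∈ Complex.slitPlane := fun A hA θ =>
    neg_dirQuot_mem_slitPlane hH (subset_convexHull ℝ _ hA) θ
  have hw0 : ∀ A ∈ 𝒜, ∀ θ, -dirQuot A θ ≠ 0 := fun A hA θ =>
    Complex.slitPlane_ne_zero (hslit A hA θ)
  obtain ⟨α, β, hα, hβ, hαp, hβp, hle, hαat, hβat⟩ := exists_extremal_angles hcompact hne hH
  have hpi := Real.pi_pos
  have hαgt : ∀ θ, -Real.pi < α θ := fun θ => by
    obtain ⟨A, -, hA⟩ := hαat θ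
    exact hA ▸ Complex.neg_pi_lt_arg _
  have hβlt : ∀ θ, β θ < Real.pi := fun θ => by
    obtain ⟨A, hA𝒜, hA⟩ := hβat θ
    rw [← hA]
    exact (Complex.arg_le_pi _).lt_of_ne (Complex.mem_slitPlane_iff_arg.1 (hslit A hA𝒜 θ)).1
  have hαβ : ∀ θ, β θ - α θ < Real.pi := fun θ => by
    obtain ⟨A, hA, hAe⟩ := hαat θ
    obtain ⟨B, hB, hBe⟩ := hβat θ
    rw [← hAe, ← hBe]
    refine arg_sub_arg_lt_pi (hslit A hA θ) (hslit B hB θ) fun a b ha hb hab => ?_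
    have := neg_dirQuot_mem_slitPlane hH ((convex_convexHull ℝ 𝒜) (subset_convexHull ℝ _ hA)
      (subset_convexHull ℝ _ hB) ha hb hab) θ
    rw [dirQuot_combo] at this
    convert this using 1
    ring
  -- `lo < γ < hi` says that `γ` and all `arg (-q) + γ` lie in `(-π/2, π/2)`. That `lo < hi` uses
  -- both `β < π` and the angular width `β - α < π`.
  set lo : ℝ → ℝ := fun θ => max (-(Real.pi / 2)) (-(Real.pi / 2) - α θ) with hlo
  set hi : ℝ → ℝ := fun θ => min (Real.pi / 2) (Real.pi / 2 - β θ) with hhi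
  have hloc : Continuous lo := by fun_prop
  have hhic : Continuous hi := by fun_prop
  have hlohi : ∀ θ, lo θ < hi θ := fun θ => by
    rw [hlo, hhi]
    simp only [max_lt_iff, lt_min_iff]
    refine ⟨⟨?_, ?_⟩, ⟨?_, ?_⟩⟩ <;> linarith [hαgt θ, hβlt θ, hαβ θ]
  have hlo1 : ∀ θ, -(Real.pi / 2) ≤ lo θ := fun θ => le_max_left _ _
  have hlo2 : ∀ θ, -(Real.pi / 2) - α θ ≤ lo θ := fun θ => le_max_right _ _
  have hhi1 : ∀ θ, hi θ ≤ Real.pi / 2 := fun θ => min_le_left _ _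
  have hhi2 : ∀ θ, hi θ ≤ Real.pi / 2 - β θ := fun θ => min_le_right _ _
  set γ : ℝ → ℝ → ℝ := fun s θ => (1 - s) * lo θ + s * hi θ with hγ
  have hγlo : ∀ s, 0 < s → ∀ θ, lo θ < γ s θ := fun s hs θ => by
    have := mul_pos hs (sub_pos.2 (hlohi θ)); simp only [hγ]; linarith
  have hγhi : ∀ s, s < 1 → ∀ θ, γ s θ < hi θ := fun s hs θ => by
    have := mul_pos (sub_pos.2 hs) (sub_pos.2 (hlohi θ)); simp only [hγ]; linarith
  have hγmem : ∀ s, 0 < s → s < 1 → ∀ θ, γ s θ ∈ Ioo (-(Real.pi / 2)) (Real.pi / 2) :=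
    fun s hs hs1 θ => ⟨(hlo1 θ).trans_lt (hγlo s hs θ), (hγhi s hs1 θ).trans_le (hhi1 θ)⟩
  have hadm : ∀ s, 0 < s → s < 1 → Admissible 𝒜 fun θ => Real.tan (γ s θ) := by
    intro s hs hs1
    have hcos : ∀ θ, 0 < Real.cos (γ s θ) := fun θ => Real.cos_pos_of_mem_Ioo (hγmem s hs hs1 θ)
    refine ⟨?_, fun θ => by simp only [hγ, hlo, hhi, hαp θ, hβp θ], fun A hA θ => ?_⟩
    · rw [continuous_iff_continuousAt]
      intro θ
      exact (Real.continuousAt_tan.2 (hcos θ).ne').comp (f := γ s)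
        (Continuous.continuousAt (by fun_prop))
    · have h1 := re_sub_tan_mul_im (hw0 A hA θ) (hcos θ).ne'
      have h2 : 0 < Real.cos ((-dirQuot A θ).arg + γ s θ) := by
        apply Real.cos_pos_of_mem_Ioo
        have l1 := hle θ A hA
        constructor
        · linarith [hγlo s hs θ, hlo2 θ]
        · linarith [hγhi s hs1 θ, hhi2 θ]
      have h3 : 0 < ‖-dirQuot A θ‖ * Real.cos ((-dirQuot A θ).arg + γ s θ) / Real.cos (γ s θ) :=
        div_pos (mul_pos (norm_pos_iff.2 (hw0 A hA θ)) h2) (hcos θ)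
      rw [← h1, Complex.neg_re, Complex.neg_im] at h3
      linarith
  have hhalf := hadm (1 / 2) (by norm_num) (by norm_num)
  -- `0 ≤ α θ₀` means that no matrix turns left in direction `θ₀`: there the slope has no lower
  -- bound.
  by_cases hcase : ∃ θ₀, 0 ≤ α θ₀
  · obtain ⟨θ₀, hθ₀⟩ := hcase
    obtain ⟨K, hK, hKL⟩ := exists_arg_dirQuot_lipschitz hcompact hne hslit
    have hαlow : ∀ θ, -(K * |θ - θ₀|) ≤ α θ := fun θ => by
      obtain ⟨A, hA, hAe⟩ := hαat θ
      have h1 := (abs_le.1 (hKL A hA θ θ₀)).1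
      have h2 := (hle θ₀ A hA).1
      linarith
    obtain ⟨C, hC0, hC⟩ : ∃ C, 0 ≤ C ∧ ∀ θ, Real.tan (γ (1 / 2) θ) ≤ C := by
      obtain ⟨C, hC⟩ := (isCompact_Icc (a := (0 : ℝ)) (b := Real.pi)).exists_bound_of_continuousOn
        hhalf.continuous.continuousOn
      refine ⟨|C|, abs_nonneg C, fun θ => ?_⟩
      obtain ⟨y, hy, hey⟩ := hhalf.periodic.exists_mem_Ico₀ hpi θ
      rw [hey]
      exact (le_abs_self _).trans ((hC y ⟨hy.1, hy.2.le⟩).trans (le_abs_self C))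
    set r := min Real.pi (1 / (2 * K)) with hr
    have hr0 : 0 < r := lt_min hpi (by positivity)
    have hrπ : r ≤ Real.pi := min_le_left _ _
    have hKr : K * r ≤ 1 / 2 := by
      have : r ≤ 1 / (2 * K) := min_le_right _ _
      calc K * r ≤ K * (1 / (2 * K)) := mul_le_mul_of_nonneg_left this hK.le
        _ = 1 / 2 := by field_simp
    -- Near `θ₀` the integral is at most `-(log (K r + κ) - log κ) / (2 K)`, elsewhere at most `C
    -- π`. This `κ` makes the first outweigh the second; `κ ≤ 1/2` and `K r ≤ 1/2` keep the distance
    -- to `-π/2` within reach of `tan_le_of_near`.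
    set κ := min (1 / 2) (K * r * Real.exp (-(2 * K * (C * Real.pi) + 1))) with hκ
    have hκ0 : 0 < κ := lt_min (by norm_num) (by positivity)
    have hκ1 : κ ≤ 1 / 2 := min_le_left _ _
    have hκ2 : Real.log κ ≤ Real.log (K * r) - (2 * K * (C * Real.pi) + 1) := by
      have := Real.log_le_log hκ0 (min_le_right (1 / 2) (K * r * Real.exp (-(2 * K * (C * Real.pi)
        + 1))))
      rw [Real.log_mul (by positivity) (Real.exp_pos _).ne', Real.log_exp] at this
      linarith
    -- As `hi - lo ≤ π`, this puts `γ s` within `κ` of `lo`.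
    set s := κ / Real.pi with hs
    have hs0 : 0 < s := div_pos hκ0 hpi
    have hsπ : s * Real.pi = κ := div_mul_cancel₀ _ hpi.ne'
    have hs12 : s ≤ 1 / 2 := by
      rw [hs, div_le_iff₀ hpi]
      linarith [Real.pi_gt_three]
    have hs1 : s < 1 := by linarith
    have hgs := hadm s hs0 hs1
    refine ⟨_, hgs, ?_⟩
    have hii : ∀ u v, IntervalIntegrable (fun θ => Real.tan (γ s θ)) volume u v := fun u v =>
      hgs.continuous.intervalIntegrable u v
    have hshift := hgs.periodic.intervalIntegral_add_eq θ₀ 0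
    rw [zero_add] at hshift
    rw [← hshift, ← intervalIntegral.integral_add_adjacent_intervals (hii θ₀ (θ₀ + r)) (hii _ _)]
    have hpos : ∀ θ ∈ Icc θ₀ (θ₀ + r), 0 < K * (θ - θ₀) + κ := fun θ hθ =>
      add_pos_of_nonneg_of_pos (mul_nonneg hK.le (by linarith [hθ.1])) hκ0
    have hpiece1 : ∫ θ in θ₀..(θ₀ + r), Real.tan (γ s θ) ≤
        -(1 / 2) * ((Real.log (K * r + κ) - Real.log κ) / K) := by
      have hlog : ∫ θ in θ₀..(θ₀ + r), (K * (θ - θ₀) + κ)⁻¹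
          = (Real.log (K * r + κ) - Real.log κ) / K := by
        have hd : ∀ θ ∈ uIcc θ₀ (θ₀ + r), HasDerivAt (fun θ => Real.log (K * (θ - θ₀) + κ) / K)
            ((K * (θ - θ₀) + κ)⁻¹) θ := by
          intro θ hθ
          rw [uIcc_of_le (by linarith)] at hθ
          have h1 : HasDerivAt (fun θ => K * (θ - θ₀) + κ) (K * 1) θ :=
            (((hasDerivAt_id θ).sub_const θ₀).const_mul K).add_const κ
          refine ((h1.log (hpos θ hθ).ne').div_const K).congr_deriv ?_
          field_simp
        rw [intervalIntegral.integral_eq_sub_of_hasDerivAt hd]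
        · simp only [add_sub_cancel_left, sub_self, mul_zero, zero_add]
          ring
        · refine ContinuousOn.intervalIntegrable ?_
          rw [uIcc_of_le (by linarith)]
          exact ContinuousOn.inv₀ (by fun_prop) fun θ hθ => (hpos θ hθ).ne'
      rw [← hlog, ← intervalIntegral.integral_const_mul]
      refine intervalIntegral.integral_mono_on (by linarith) (hii _ _) ?_ fun θ hθ => ?_
      · refine ContinuousOn.intervalIntegrable ?_
        rw [uIcc_of_le (by linarith)]
        exact continuousOn_const.mul
          (ContinuousOn.inv₀ (by fun_prop) fun θ hθ => (hpos θ hθ).ne')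
      · refine tan_le_of_near (hγmem s hs0 hs1 θ).1 ?_ ?_
        · have h1 : lo θ ≤ -(Real.pi / 2) + K * (θ - θ₀) := by
            have h2 := hαlow θ
            rw [abs_of_nonneg (by linarith [hθ.1])] at h2
            refine max_le ?_ (by linarith)
            linarith [mul_nonneg hK.le (sub_nonneg.2 hθ.1)]
          have h3 : γ s θ ≤ lo θ + s * Real.pi := by
            have : s * (hi θ - lo θ) ≤ s * Real.pi :=
              mul_le_mul_of_nonneg_left (by linarith [hhi1 θ, hlo1 θ]) hs0.le
            simp only [hγ]; linarith
          linarith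
        · have := mul_le_mul_of_nonneg_left (show θ - θ₀ ≤ r by linarith [hθ.2]) hK.le
          linarith
    have hpiece2 : ∫ θ in (θ₀ + r)..(θ₀ + Real.pi), Real.tan (γ s θ) ≤ C * Real.pi := by
      have h1 := intervalIntegral.integral_mono_on (a := θ₀ + r) (b := θ₀ + Real.pi) (by linarith)
        (hii _ _) (intervalIntegrable_const (c := C)) fun θ _ => (?_ : Real.tan (γ s θ) ≤ C)
      · rw [intervalIntegral.integral_const, smul_eq_mul] at h1
        nlinarith
      · refine le_trans ?_ (hC θ)
        refine Real.strictMonoOn_tan.monotoneOn (hγmem s hs0 hs1 θ)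
          (hγmem (1 / 2) (by norm_num) (by norm_num) θ) ?_
        have := mul_le_mul_of_nonneg_right hs12 (sub_pos.2 (hlohi θ)).le
        simp only [hγ]; linarith
    have hmain : 2 * K * (C * Real.pi) + 1 ≤ Real.log (K * r + κ) - Real.log κ := by
      have := Real.log_le_log (by positivity : 0 < K * r) (by linarith : K * r ≤ K * r + κ)
      linarith
    have hmain2 : C * Real.pi < 1 / 2 * ((Real.log (K * r + κ) - Real.log κ) / K) := by
      rw [← mul_div_assoc, lt_div_iff₀ hK]
      linarith
    linarith
  · push Not at hcase
    obtain ⟨A, x, T, hx0, hr⟩ := exists_isRoundLeft hcompact hne hslit hα hαp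
      (fun θ A hA => (hle θ A hA).1) hαat hcase hx₀
    have hI := hround A x T _ hx0 hr
    rw [Real.exp_lt_one_iff] at hI
    set a : ℝ → ℝ := fun θ => Real.tan (-(Real.pi / 2) - α θ) with ha
    have hcos : ∀ θ, 0 < Real.cos (-(Real.pi / 2) - α θ) := fun θ =>
      Real.cos_pos_of_mem_Ioo ⟨by linarith [hcase θ], by linarith [hαgt θ]⟩
    have hac : Continuous a := by
      rw [continuous_iff_continuousAt]
      intro θ
      exact (Real.continuousAt_tan.2 (hcos θ).ne').comp (f := fun θ => -(Real.pi / 2) - α θ)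
        (Continuous.continuousAt (by fun_prop))
    have hap : Function.Periodic a Real.pi := fun θ => by simp only [ha, hαp θ]
    have hale : ∀ A ∈ 𝒜, ∀ θ, (dirQuot A θ).re - a θ * (dirQuot A θ).im ≤ 0 := by
      intro A hA θ
      have h1 := re_sub_tan_mul_im (hw0 A hA θ) (hcos θ).ne'
      have l1 := hle θ A hA
      have h2 : 0 ≤ Real.cos ((-dirQuot A θ).arg + (-(Real.pi / 2) - α θ)) :=
        Real.cos_nonneg_of_neg_pi_div_two_le_of_le (by linarith) (by linarith [hαβ θ])
      have h3 : 0 ≤ ‖-dirQuot A θ‖ * Real.cos ((-dirQuot A θ).arg + (-(Real.pi / 2) - α θ))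
          / Real.cos (-(Real.pi / 2) - α θ) :=
        div_nonneg (mul_nonneg (norm_nonneg _) h2) (hcos θ).le
      rw [← h1, Complex.neg_re, Complex.neg_im] at h3
      simp only [ha]
      linarith
    set I := ∫ θ in (0 : ℝ)..Real.pi, a θ
    set J := ∫ θ in (0 : ℝ)..Real.pi, Real.tan (γ (1 / 2) θ)
    have hD : 0 < |J| - I := by linarith [abs_nonneg J]
    -- Chosen so that `s (|J| - I) = -I / 2`, which leaves a mean of at most `I / 2 < 0`.
    set s := -I / (2 * (|J| - I)) with hs
    have hs0 : 0 < s := div_pos (by linarith) (by linarith)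
    have hs1 : s ≤ 1 := by
      rw [hs, div_le_one (by linarith)]
      linarith [abs_nonneg J]
    refine ⟨_, Admissible.combo hac hap hale hhalf hs0 hs1, ?_⟩
    rw [integral_combo hac hhalf.continuous]
    have h1 : s * (|J| - I) = -I / 2 := by rw [hs]; field_simp
    have h2 : s * (J - I) ≤ s * (|J| - I) :=
      mul_le_mul_of_nonneg_left (by linarith [le_abs_self J]) hs0.le
    change (1 - s) * I + s * J < 0
    linarith

/-! ### Reflection: exchanging left and right -/

/-- Reflection of the plane in the first axis. -/
noncomputable def reflVec (x : Vec2) : Vec2 := ![x 0, -x 1]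

/-- Conjugation of a matrix by the reflection in the first axis. -/
noncomputable def reflMat : Mat2 →ₗ[ℝ] Mat2 where
  toFun A := !![A 0 0, -A 0 1; -A 1 0, A 1 1]
  map_add' A B := by ext i j; fin_cases i <;> fin_cases j <;> simp <;> ring
  map_smul' r A := by ext i j; fin_cases i <;> fin_cases j <;> simp

theorem reflVec_reflVec (x : Vec2) : reflVec (reflVec x) = x := by
  ext i; fin_cases i <;> simp [reflVec]

theorem reflMat_reflMat (A : Mat2) : reflMat (reflMat A) = A := by
  ext i j; fin_cases i <;> fin_cases j <;> simp [reflMat]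

theorem reflVec_smul (r : ℝ) (x : Vec2) : reflVec (r • x) = r • reflVec x := by
  ext i; fin_cases i <;> simp [reflVec]

theorem reflVec_neg (x : Vec2) : reflVec (-x) = -reflVec x := by
  ext i; fin_cases i <;> simp [reflVec]

theorem reflVec_ne_zero {x : Vec2} (hx : x ≠ 0) : reflVec x ≠ 0 := by
  intro h
  apply hx
  rw [← reflVec_reflVec x, h]
  ext i; fin_cases i <;> simp [reflVec]

theorem reflMat_mulVec (A : Mat2) (x : Vec2) : reflMat A *ᵥ reflVec x = reflVec (A *ᵥ x) := by
  ext i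
  fin_cases i <;> simp [reflMat, reflVec, Matrix.mulVec, dotProduct, Fin.sum_univ_two]
  ring

theorem toC_reflVec (x : Vec2) : toC (reflVec x) = conj (toC x) := by
  apply Complex.ext <;> simp [toC, reflVec]

theorem dirQuot_reflMat (A : Mat2) (θ : ℝ) : dirQuot (reflMat A) θ = conj (dirQuot A (-θ)) := by
  have h1 : holPart (reflMat A) = conj (holPart A) := by
    simp only [holPart, map_add, map_mul, Complex.conj_ofReal, Complex.conj_I]
    simp [reflMat]; ring
  have h2 : antiPart (reflMat A) = conj (antiPart A) := by
    simp only [antiPart, map_add, map_mul, Complex.conj_ofReal, Complex.conj_I]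
    simp [reflMat]; ring
  rw [dirQuot, dirQuot, h1, h2, map_add, map_mul, ← Complex.exp_conj]
  simp only [map_mul, map_neg, Complex.conj_ofReal, Complex.conj_I]
  congr 3
  push_cast
  ring

theorem image_reflMat_reflMat (𝒜 : Set Mat2) : reflMat '' (reflMat '' 𝒜) = 𝒜 := by
  rw [image_image]
  simp [reflMat_reflMat]

theorem continuous_reflMat : Continuous reflMat := reflMat.continuous_of_finiteDimensional

theorem HullHasNonnegEigenvalue.of_reflMat {𝒜 : Set Mat2}
    (h : HullHasNonnegEigenvalue (reflMat '' 𝒜)) : HullHasNonnegEigenvalue 𝒜 := by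
  obtain ⟨B, hB, c, hc, hev⟩ := h
  rw [← LinearMap.image_convexHull] at hB
  obtain ⟨B, hB, rfl⟩ := hB
  obtain ⟨v, hv⟩ := hev.exists_hasEigenvector
  have hv1 : reflMat B *ᵥ v = c • v := by simpa using hv.apply_eq_smul
  refine ⟨B, hB, c, hc, Module.End.hasEigenvalue_of_hasEigenvector (x := reflVec v)
    ⟨?_, reflVec_ne_zero hv.2⟩⟩
  rw [Module.End.mem_eigenspace_iff, Matrix.toLin'_apply]
  have := reflMat_mulVec (reflMat B) v
  rwa [reflMat_reflMat, hv1, reflVec_smul] at this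

/-- Conjugation negates the argument except at `π`, which the range `(-π, π]` forces to stay fixed.
-/
theorem orientedAngle_reflVec (x : Vec2) (B : Mat2) :
    orientedAngle (reflVec x) (reflMat B *ᵥ reflVec x) =
      if orientedAngle x (B *ᵥ x) = Real.pi then Real.pi else -orientedAngle x (B *ᵥ x) := by
  rw [orientedAngle, orientedAngle, reflMat_mulVec, toC_reflVec, toC_reflVec, ← map_div₀,
    Complex.arg_conj]

theorem euclLength_reflVec (x : Vec2) : euclLength (reflVec x) = euclLength x := by
  rw [euclLength, euclLength, toC_reflVec, RCLike.norm_conj]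

theorem Feasible.refl {𝒜 : Set Mat2} {x : Vec2} (h : Feasible 𝒜 x) :
    Feasible (reflMat '' 𝒜) (reflVec x) := by
  rintro ⟨_, ⟨A, hA, rfl⟩, c, hc, he⟩
  refine h ⟨A, hA, c, hc, ?_⟩
  rw [reflMat_mulVec, ← reflVec_smul] at he
  rw [← reflVec_reflVec (A *ᵥ x), he, reflVec_reflVec]

theorem orientedAngle_reflVec_of_ne {x : Vec2} {B : Mat2}
    (h : orientedAngle x (B *ᵥ x) ≠ Real.pi) :
    orientedAngle (reflVec x) (reflMat B *ᵥ reflVec x) = -orientedAngle x (B *ᵥ x) := by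
  rw [orientedAngle_reflVec, if_neg h]

theorem orientedAngle_ne_pi_of_reflVec {x : Vec2} {B : Mat2} {a : ℝ}
    (h : orientedAngle (reflVec x) (reflMat B *ᵥ reflVec x) = a) (ha : a ≠ Real.pi) :
    orientedAngle x (B *ᵥ x) ≠ Real.pi := by
  intro h0
  rw [orientedAngle_reflVec, if_pos h0] at h
  exact ha h.symm

theorem IsLeadingLeft.refl {𝒜 : Set Mat2} {x : Vec2} {A : Mat2} (h : IsLeadingLeft 𝒜 x A) :
    IsLeadingRight (reflMat '' 𝒜) (reflVec x) (reflMat A) := by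
  have hpi := Real.pi_pos
  have hm := h.angle_mem
  have hA := orientedAngle_reflVec_of_ne hm.2.ne
  refine ⟨h.feasible.refl, ⟨A, h.mem, rfl⟩, ?_, ?_, ?_⟩
  · rw [hA]
    exact ⟨by linarith [hm.2], by linarith [hm.1]⟩
  · rintro _ ⟨B, hB, rfl⟩ hBm
    have hne := orientedAngle_ne_pi_of_reflVec rfl (hBm.2.trans hpi).ne
    have hBe := orientedAngle_reflVec_of_ne hne
    rw [hBe] at hBm ⊢
    rw [hA]
    have := h.angle_le B hB ⟨by linarith [hBm.2], by linarith [hBm.1]⟩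
    linarith
  · rintro _ ⟨B, hB, rfl⟩ hBe
    rw [hA] at hBe
    have hne := orientedAngle_ne_pi_of_reflVec hBe (by linarith [hm.1])
    rw [orientedAngle_reflVec_of_ne hne, neg_inj] at hBe
    rw [reflMat_mulVec, reflMat_mulVec, euclLength_reflVec, euclLength_reflVec]
    exact h.length_le B hB hBe

theorem IsLeadingRight.refl {𝒜 : Set Mat2} {x : Vec2} {A : Mat2} (h : IsLeadingRight 𝒜 x A) :
    IsLeadingLeft (reflMat '' 𝒜) (reflVec x) (reflMat A) := by
  have hpi := Real.pi_pos
  have hm := h.angle_mem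
  have hA := orientedAngle_reflVec_of_ne (hm.2.trans hpi).ne
  refine ⟨h.feasible.refl, ⟨A, h.mem, rfl⟩, ?_, ?_, ?_⟩
  · rw [hA]
    exact ⟨by linarith [hm.2], by linarith [hm.1]⟩
  · rintro _ ⟨B, hB, rfl⟩ hBm
    have hne := orientedAngle_ne_pi_of_reflVec rfl hBm.2.ne
    have hBe := orientedAngle_reflVec_of_ne hne
    rw [hBe] at hBm ⊢
    rw [hA]
    have := h.le_angle B hB ⟨by linarith [hBm.2], by linarith [hBm.1]⟩
    linarith
  · rintro _ ⟨B, hB, rfl⟩ hBe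
    rw [hA] at hBe
    have hne := orientedAngle_ne_pi_of_reflVec hBe (by linarith [hm.1])
    rw [orientedAngle_reflVec_of_ne hne, neg_inj] at hBe
    rw [reflMat_mulVec, reflMat_mulVec, euclLength_reflVec, euclLength_reflVec]
    exact h.length_le B hB hBe

theorem IsTrajectory.refl {𝒜 : Set Mat2} {A : ℝ → Mat2} {x : ℝ → Vec2}
    (h : IsTrajectory 𝒜 A x) :
    IsTrajectory (reflMat '' 𝒜) (fun t => reflMat (A t)) (fun t => reflVec (x t)) := by
  have hz := isTrajectory_iff.1 h
  rw [isTrajectory_iff]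
  simp only [toC_reflVec]
  refine ⟨fun i j => ?_, fun t ht => ⟨A t, h.law_mem t ht, rfl⟩,
    Complex.continuous_conj.comp_continuousOn hz.continuousOn, fun t ht => ?_⟩
  · have := h.measurable_law
    fin_cases i <;> fin_cases j
    · exact this 0 0
    · exact (this 0 1).neg
    · exact (this 1 0).neg
    · exact this 1 1
  · have e : ∀ s, opC (reflMat (A s)) (conj (toC (x s))) = conj (opC (A s) (toC (x s))) := by
      intro s
      rw [← toC_reflVec, ← toC_mulVec, reflMat_mulVec, toC_reflVec, toC_mulVec]
    simp only [e]
    rw [hz.solves t ht, map_add, intervalIntegral.integral_of_le ht,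
      intervalIntegral.integral_of_le ht, integral_conj]

theorem IsRound.refl {A : ℝ → Mat2} {x : ℝ → Vec2} {T c : ℝ} (h : IsRound A x T c) :
    IsRound (fun t => reflMat (A t)) (fun t => reflVec (x t)) T c := by
  refine ⟨reflVec_ne_zero h.start_ne_zero, h.time_pos, h.factor_pos, ?_, ?_, fun t ht => ?_⟩
  · rw [h.half_turn, reflVec_neg, reflVec_smul]
  · rintro s hs hsT ⟨d, hd, he⟩
    refine h.first_time s hs hsT ⟨d, hd, ?_⟩
    rw [← reflVec_smul, ← reflVec_neg] at he
    rw [← reflVec_reflVec (x s), he, reflVec_reflVec]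
  · rw [h.periodic_law t ht]

theorem IsRoundLeft.refl {𝒜 : Set Mat2} {A : ℝ → Mat2} {x : ℝ → Vec2} {T c : ℝ}
    (h : IsRoundLeft 𝒜 A x T c) :
    IsRoundRight (reflMat '' 𝒜) (fun t => reflMat (A t)) (fun t => reflVec (x t)) T c :=
  ⟨h.trajectory.refl, fun t ht => (h.leading t ht).refl, h.round.refl⟩

theorem IsRoundRight.refl {𝒜 : Set Mat2} {A : ℝ → Mat2} {x : ℝ → Vec2} {T c : ℝ}
    (h : IsRoundRight 𝒜 A x T c) :
    IsRoundLeft (reflMat '' 𝒜) (fun t => reflMat (A t)) (fun t => reflVec (x t)) T c :=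
  ⟨h.trajectory.refl, fun t ht => (h.leading t ht).refl, h.round.refl⟩

/-- A round leading right trajectory can be restarted at any nonzero point. -/
theorem IsRoundRight.exists_start {𝒜 : Set Mat2} (hcompact : IsCompact 𝒜) {A : ℝ → Mat2}
    {x : ℝ → Vec2} {T c : ℝ} (h : IsRoundRight 𝒜 A x T c) {y₀ : Vec2} (hy₀ : y₀ ≠ 0) :
    ∃ A' x', x' 0 = y₀ ∧ IsRoundRight 𝒜 A' x' T c := by
  obtain ⟨A', x', h0, hr⟩ :=
    h.refl.exists_start (hcompact.image continuous_reflMat) (reflVec_ne_zero hy₀)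
  have := hr.refl
  rw [image_reflMat_reflMat] at this
  exact ⟨_, _, by rw [h0, reflVec_reflVec], this⟩

/-- If `g` is admissible for the reflected family, `θ ↦ -g (-θ)` is admissible for the original one,
and its integral over a period changes sign. -/
theorem exists_admissible_of_right {𝒜 : Set Mat2} (hcompact : IsCompact 𝒜) (hne : 𝒜.Nonempty)
    (hH : ¬ HullHasNonnegEigenvalue 𝒜) {x₀ : Vec2} (hx₀ : x₀ ≠ 0)
    (hround : ∀ (A : ℝ → Mat2) (x : ℝ → Vec2) (T c : ℝ), x 0 = x₀ →
      IsRoundRight 𝒜 A x T c → c < 1) :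
    ∃ g, Admissible 𝒜 g ∧ 0 < ∫ θ in (0 : ℝ)..Real.pi, g θ := by
  obtain ⟨g, hg, hgi⟩ := exists_admissible_of_left (hcompact.image continuous_reflMat)
    (hne.image _) (fun h => hH h.of_reflMat) (reflVec_ne_zero hx₀) (fun A x T c h0 hr => by
      have := hr.refl
      rw [image_reflMat_reflMat] at this
      exact hround _ _ T c (by rw [h0, reflVec_reflVec]) this)
  have hc := hg.continuous
  refine ⟨fun θ => -g (-θ), ⟨by fun_prop, fun θ => ?_, fun A hA θ => ?_⟩, ?_⟩
  · have := hg.periodic (-(θ + Real.pi))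
    rw [show -(θ + Real.pi) + Real.pi = -θ by ring] at this
    rw [this]
  · have := hg.lt _ ⟨A, hA, rfl⟩ (-θ)
    rw [dirQuot_reflMat, neg_neg, Complex.conj_re, Complex.conj_im] at this
    linarith
  · rw [intervalIntegral.integral_neg, intervalIntegral.integral_comp_neg g, neg_zero]
    have := hg.periodic.intervalIntegral_add_eq (-Real.pi) 0
    rw [neg_add_cancel, zero_add] at this
    rw [this]
    linarith

/-! ### Conclusion -/

/-- Two admissible fields with means of opposite signs have an admissible convex combination of mean
zero; the weight `-I / (J - I)` is the one that cancels the integrals. -/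
theorem stableSystem_of_roundDecreasingFrom {𝒜 : Set Mat2} (hcompact : IsCompact 𝒜)
    (hne : 𝒜.Nonempty) (hH : ¬ HullHasNonnegEigenvalue 𝒜) {x₀ : Vec2} (hx₀ : x₀ ≠ 0)
    (hround : RoundDecreasingFrom 𝒜 x₀) : StableSystem 𝒜 := by
  obtain ⟨g₁, h₁, hi₁⟩ := exists_admissible_of_left hcompact hne hH hx₀ hround.1
  obtain ⟨g₂, h₂, hi₂⟩ := exists_admissible_of_right hcompact hne hH hx₀ hround.2
  set I := ∫ θ in (0 : ℝ)..Real.pi, g₁ θ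
  set J := ∫ θ in (0 : ℝ)..Real.pi, g₂ θ
  have hD : 0 < J - I := by linarith
  have hadm := Admissible.combo h₁.continuous h₁.periodic (fun A hA θ => (h₁.lt A hA θ).le) h₂
    (s := -I / (J - I)) (div_pos (by linarith) hD) ((div_le_one hD).2 (by linarith))
  refine stable_of_slope hcompact hadm.continuous hadm.periodic ?_ hadm.lt
  rw [integral_combo h₁.continuous h₂.continuous]
  change (1 - -I / (J - I)) * I + -I / (J - I) * J = 0
  field_simp
  ring

/-- The empty family leaves every line invariant. -/
theorem IrreducibleFamily.nonempty {𝒜 : Set Mat2} (h : IrreducibleFamily 𝒜) : 𝒜.Nonempty := by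
  rw [nonempty_iff_ne_empty]
  rintro rfl
  have hv : (![1, 0] : Vec2) ≠ 0 := fun h0 => by simpa using congrFun h0 0
  rcases h (ℝ ∙ (![1, 0] : Vec2)) (by simp) with h1 | h1
  · exact hv (Submodule.span_singleton_eq_bot.1 h1)
  · have : (![0, 1] : Vec2) ∈ (ℝ ∙ (![1, 0] : Vec2)) := h1 ▸ Submodule.mem_top
    obtain ⟨r, hr⟩ := Submodule.mem_span_singleton.1 this
    simpa using congrFun hr 1

theorem mainTheorem3 (𝒜 : Set Mat2) (hcompact : IsCompact 𝒜) (hirr : IrreducibleFamily 𝒜) :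
    -- the criterion, over all round leading trajectories
    (StableSystem 𝒜 ↔
      ¬ HullHasNonnegEigenvalue 𝒜 ∧ ∀ x₀ : Vec2, x₀ ≠ 0 → RoundDecreasingFrom 𝒜 x₀) ∧
    -- the criterion, with one arbitrarily chosen starting point
    (∀ x₀ : Vec2, x₀ ≠ 0 →
      (StableSystem 𝒜 ↔ ¬ HullHasNonnegEigenvalue 𝒜 ∧ RoundDecreasingFrom 𝒜 x₀)) ∧
    -- a round leading trajectory, if there is one, exists from every starting point
    (∀ T c : ℝ, (∃ A x, IsRoundLeft 𝒜 A x T c) →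
      ∀ x₀ : Vec2, x₀ ≠ 0 → ∃ A x, x 0 = x₀ ∧ IsRoundLeft 𝒜 A x T c) ∧
    (∀ T c : ℝ, (∃ A x, IsRoundRight 𝒜 A x T c) →
      ∀ x₀ : Vec2, x₀ ≠ 0 → ∃ A x, x 0 = x₀ ∧ IsRoundRight 𝒜 A x T c) := by
  have hne := hirr.nonempty
  have hdec : StableSystem 𝒜 → ∀ x₀, RoundDecreasingFrom 𝒜 x₀ := fun hst x₀ =>
    ⟨fun A x T c _ hr => hr.round.factor_lt_one hcompact hst hr.trajectory,
      fun A x T c _ hr => hr.round.factor_lt_one hcompact hst hr.trajectory⟩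
  refine ⟨⟨fun hst => ⟨hst.not_hullHasNonnegEigenvalue hcompact, fun x₀ _ => hdec hst x₀⟩,
    fun h => ?_⟩, fun x₀ hx₀ => ⟨fun hst => ⟨hst.not_hullHasNonnegEigenvalue hcompact,
      hdec hst x₀⟩, fun h => stableSystem_of_roundDecreasingFrom hcompact hne h.1 hx₀ h.2⟩,
    fun T c ⟨A, x, hr⟩ x₀ hx₀ => hr.exists_start hcompact hx₀,
    fun T c ⟨A, x, hr⟩ x₀ hx₀ => hr.exists_start hcompact hx₀⟩
  -- One starting point already suffices for stability; `(1, 0)` is an arbitrary choice.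
  have hv : (![1, 0] : Vec2) ≠ 0 := fun h0 => by simpa using congrFun h0 0
  exact stableSystem_of_roundDecreasingFrom hcompact hne h.1 hv (h.2 _ hv)
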